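/- Let $\alpha \ge 0$, $0 \le \beta < \tfrac32 + \alpha$, $0 \le \nu < 3$ and $\nu \le 2\beta$. For $b > 0$ let $H_b$ be the self-adjoint operator in the complex Hilbert space $L^2(b,b+1)$ associated with the closed quadratic form $$h_b[u] = \int_b^{b+1} \left| \left( \frac{1}{x^{\alpha}} \left( \frac{u(x)}{x^{\beta}} \right)' \right)' \right|^2 x^{2(\alpha+\beta)} \, dx$$ with form domain the Sobolev space $H^2(b,b+1)$ (no boundary conditions imposed). For a bounded real function $V$ on $(b,b+1)$ let $H_b - V$ be the operator sum, with the domain of $H_b$. Then there are constants $D_\nu, E_\nu > 0$, depending only on $\alpha$, $\beta$ and $\nu$, such that for every $b > 0$ and every bounded measurable $V \ge 0$ on $(b,b+1)$ that is not almost everywhere zero and satisfies $$\int_b^{b+1} V(x)\, x^{\nu} \, dx \le D_\nu ,$$ the negative spectrum of $H_b - V$ consists of exactly two eigenvalues, counted with multiplicity, $-E_1$ and $-E_2$, and they satisfy $0 < E_1 \le E_\nu$ and $0 < E_2 \le E_\nu$. -/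

import Mathlib

open MeasureTheory Set
open scoped ENNReal ContDiff ComplexConjugate

noncomputable section

namespace IntervalOp

/-- Lebesgue measure on the interval `(b, b + 1)`. -/
abbrev μ (b : ℝ) : Measure ℝ := volume.restrict (Ioo b (b + 1))

/-- The complex Hilbert space `L²(b, b + 1)`. -/
abbrev L2 (b : ℝ) : Type := Lp ℂ 2 (μ b)

/-! ### Multiplication operators -/

/-- Multiplication by an essentially bounded real function, as an operator on `L²(b, b + 1)`. -/
def mulOp {b : ℝ} (m : ℝ → ℝ) (hm : MemLp m ∞ (μ b)) : L2 b →ₗ[ℂ] L2 b where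
  toFun u := (hm.toLp m • u : L2 b)
  map_add' u v := Lp.add_smul _ u v
  map_smul' c u := by
    simp only [Lp.smul_def, ← MemLp.toLp_const_smul, RingHom.id_apply]
    apply MemLp.toLp_congr
    filter_upwards [Lp.coeFn_smul c u] with x hx
    simp only [Pi.smul_apply', hx, Pi.smul_apply]
    exact smul_comm _ _ _

theorem coeFn_mulOp {b : ℝ} (m : ℝ → ℝ) (hm : MemLp m ∞ (μ b)) (u : L2 b) :
    mulOp m hm u =ᵐ[μ b] fun x => (m x : ℂ) * u x := by
  filter_upwards [Lp.coeFn_lpSMul (r := 2) (hm.toLp m) u, hm.coeFn_toLp] with x h1 h2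
  change (hm.toLp m • u : L2 b) x = _
  rw [h1, Pi.smul_apply', h2, Complex.real_smul]

theorem memLp_rpow {b : ℝ} (hb : 0 < b) (s : ℝ) : MemLp (fun x : ℝ => x ^ s) ∞ (μ b) := by
  have hc : ContinuousOn (fun x : ℝ => x ^ s) (Icc b (b + 1)) := fun x hx =>
    (Real.continuousAt_rpow_const x s (Or.inl (hb.trans_le hx.1).ne')).continuousWithinAt
  obtain ⟨C, hC⟩ := isCompact_Icc.exists_bound_of_continuousOn hc
  refine memLp_top_of_bound
    ((hc.mono Ioo_subset_Icc_self).aestronglyMeasurable measurableSet_Ioo) C ?_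
  filter_upwards [ae_restrict_mem measurableSet_Ioo] with x hx
  exact hC x (Ioo_subset_Icc_self hx)

/-- Multiplication by `x ^ s` on `L²(b, b + 1)`, `b > 0`. -/
def powOp {b : ℝ} (hb : 0 < b) (s : ℝ) : L2 b →ₗ[ℂ] L2 b :=
  mulOp (fun x => x ^ s) (memLp_rpow hb s)

/-! ### Weak derivatives and the Sobolev space `H²(b, b + 1)` -/

/-- `φ` is a (real) test function on `(b, b + 1)`, that is, `φ ∈ C_c^∞(b, b + 1)`. -/
structure IsTest (b : ℝ) (φ : ℝ → ℝ) : Prop where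
  smooth : ContDiff ℝ ∞ φ
  compact : HasCompactSupport φ
  supp : tsupport φ ⊆ Ioo b (b + 1)

/-- `g` is the weak derivative of `f` on `(b, b + 1)`. -/
def HasWeakDeriv {b : ℝ} (f g : L2 b) : Prop :=
  ∀ φ : ℝ → ℝ, IsTest b φ →
    ∫ x in Ioo b (b + 1), ((deriv φ x : ℝ) : ℂ) * f x =
      -∫ x in Ioo b (b + 1), ((φ x : ℝ) : ℂ) * g x

theorem IsTest.deriv {b : ℝ} {φ : ℝ → ℝ} (h : IsTest b φ) : IsTest b (deriv φ) where
  smooth := (contDiff_infty_iff_deriv.1 h.smooth).2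
  compact := h.compact.deriv
  supp := (tsupport_deriv_subset (𝕜 := ℝ) (f := φ)).trans h.supp

theorem IsTest.memLp {b : ℝ} {φ : ℝ → ℝ} (h : IsTest b φ) (p : ℝ≥0∞) :
    MemLp (fun x => (φ x : ℂ)) p (μ b) := by
  have h1 : Continuous (fun x => (φ x : ℂ)) := Complex.continuous_ofReal.comp h.smooth.continuous
  exact (h1.memLp_of_hasCompactSupport (μ := volume)
    (h.compact.comp_left (g := Complex.ofReal) rfl)).restrict _

theorem IsTest.integrable_mul {b : ℝ} {φ : ℝ → ℝ} (h : IsTest b φ) (f : L2 b) :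
    Integrable (fun x => (φ x : ℂ) * f x) (μ b) :=
  (h.memLp 2).integrable_mul (Lp.memLp f)

theorem HasWeakDeriv.add {b : ℝ} {f g f' g' : L2 b} (h : HasWeakDeriv f g)
    (h' : HasWeakDeriv f' g') : HasWeakDeriv (f + f') (g + g') := by
  intro φ hφ
  have e (ψ : ℝ → ℝ) (hψ : IsTest b ψ) (u v : L2 b) :
      ∫ x in Ioo b (b + 1), ((ψ x : ℝ) : ℂ) * (u + v : L2 b) x =
        (∫ x in Ioo b (b + 1), ((ψ x : ℝ) : ℂ) * u x) +
          ∫ x in Ioo b (b + 1), ((ψ x : ℝ) : ℂ) * v x := by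
    rw [← integral_add (hψ.integrable_mul u) (hψ.integrable_mul v)]
    apply integral_congr_ae
    filter_upwards [Lp.coeFn_add u v] with x hx
    rw [hx, Pi.add_apply, mul_add]
  rw [e _ hφ.deriv, e _ hφ, h φ hφ, h' φ hφ]
  ring

theorem HasWeakDeriv.smul {b : ℝ} {f g : L2 b} (c : ℂ) (h : HasWeakDeriv f g) :
    HasWeakDeriv (c • f) (c • g) := by
  intro φ hφ
  have e (ψ : ℝ → ℝ) (u : L2 b) :
      ∫ x in Ioo b (b + 1), ((ψ x : ℝ) : ℂ) * (c • u : L2 b) x =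
        c * ∫ x in Ioo b (b + 1), ((ψ x : ℝ) : ℂ) * u x := by
    rw [← integral_const_mul]
    apply integral_congr_ae
    filter_upwards [Lp.coeFn_smul c u] with x hx
    rw [hx, Pi.smul_apply, smul_eq_mul]
    ring
  rw [e, e, h φ hφ]
  ring

theorem hasWeakDeriv_zero {b : ℝ} : HasWeakDeriv (0 : L2 b) 0 := by
  have e (ψ : ℝ → ℝ) : ∫ x in Ioo b (b + 1), ((ψ x : ℝ) : ℂ) * (0 : L2 b) x = 0 := by
    apply integral_eq_zero_of_ae
    filter_upwards [Lp.coeFn_zero ℂ 2 (μ b)] with x hx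
    rw [hx]
    simp
  intro φ _
  rw [e, e, neg_zero]

/-- An element of `L²(b, b + 1)` that annihilates all test functions is zero. -/
theorem eq_zero_of_test {b : ℝ} (g : L2 b)
    (h : ∀ φ : ℝ → ℝ, IsTest b φ → ∫ x in Ioo b (b + 1), ((φ x : ℝ) : ℂ) * g x = 0) :
    g = 0 := by
  have hint : IntegrableOn g (Ioo b (b + 1)) volume :=
    (Lp.memLp g).integrable (by norm_num)
  have h0 := isOpen_Ioo.ae_eq_zero_of_integral_contDiff_smul_eq_zero (μ := volume)
    (f := (g : ℝ → ℂ)) (U := Ioo b (b + 1)) hint.locallyIntegrableOn (by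
      intro φ h1 h2 h3
      rw [← h φ ⟨h1, h2, h3⟩, setIntegral_eq_integral_of_forall_compl_eq_zero]
      · simp only [Complex.real_smul]
      · intro x hx
        have : φ x = 0 := image_eq_zero_of_notMem_tsupport fun hx' => hx (h3 hx')
        simp [this])
  rw [Lp.eq_zero_iff_ae_eq_zero]
  exact (ae_restrict_iff' measurableSet_Ioo).2 h0

/-- The graph of weak differentiation in `L²(b, b + 1)`. -/
def weakDerivGraph (b : ℝ) : Submodule ℂ (L2 b × L2 b) where
  carrier := {p | HasWeakDeriv p.1 p.2}
  add_mem' h h' := HasWeakDeriv.add h h'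
  zero_mem' := hasWeakDeriv_zero
  smul_mem' c _ h := HasWeakDeriv.smul c h

theorem weakDerivGraph_functional (b : ℝ) (p : L2 b × L2 b) (hp : p ∈ weakDerivGraph b)
    (h0 : p.1 = 0) : p.2 = 0 := by
  refine eq_zero_of_test _ fun φ hφ => ?_
  have h : HasWeakDeriv p.1 p.2 := hp
  rw [h0] at h
  have h1 := h φ hφ
  rw [eq_comm, neg_eq_iff_eq_neg] at h1
  rw [h1, neg_eq_zero]
  apply integral_eq_zero_of_ae
  filter_upwards [Lp.coeFn_zero ℂ 2 (μ b)] with x hx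
  rw [hx]
  simp

/-- The weak derivative `u ↦ u'`, an unbounded operator in `L²(b, b + 1)` with domain
`H¹(b, b + 1)`. -/
def weakD (b : ℝ) : L2 b →ₗ.[ℂ] L2 b := (weakDerivGraph b).toLinearPMap

theorem mem_graph_weakD {b : ℝ} {f g : L2 b} :
    (f, g) ∈ (weakD b).graph ↔ HasWeakDeriv f g := by
  rw [weakD, Submodule.toLinearPMap_graph_eq _ (weakDerivGraph_functional b)]
  rfl

theorem mem_domain_weakD {b : ℝ} {f : L2 b} :
    f ∈ (weakD b).domain ↔ ∃ g, HasWeakDeriv f g := by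
  simp only [LinearPMap.mem_domain_iff, mem_graph_weakD]

/-- The Sobolev space `H²(b, b + 1)`: all `u ∈ L²` with weak derivatives `u', u'' ∈ L²`. -/
def H2 (b : ℝ) : Submodule ℂ (L2 b) where
  carrier := {u | ∃ u₁ u₂ : L2 b, HasWeakDeriv u u₁ ∧ HasWeakDeriv u₁ u₂}
  add_mem' := by
    rintro _ _ ⟨u₁, u₂, h1, h2⟩ ⟨v₁, v₂, h3, h4⟩
    exact ⟨u₁ + v₁, u₂ + v₂, h1.add h3, h2.add h4⟩
  zero_mem' := ⟨0, 0, hasWeakDeriv_zero, hasWeakDeriv_zero⟩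
  smul_mem' := by
    rintro c _ ⟨u₁, u₂, h1, h2⟩
    exact ⟨c • u₁, c • u₂, h1.smul c, h2.smul c⟩

/-- The product rule for multiplication by a power of `x`. -/
theorem HasWeakDeriv.rpowMul {b : ℝ} (hb : 0 < b) (s : ℝ) {f g : L2 b} (h : HasWeakDeriv f g) :
    HasWeakDeriv (powOp hb s f) (powOp hb s g + (s : ℂ) • powOp hb (s - 1) f) := by
  intro φ hφ
  have hpos : ∀ x ∈ Ioo b (b + 1), 0 < x := fun x hx => hb.trans hx.1
  -- `x ^ r φ` is again a test function
  have key (r : ℝ) : IsTest b (fun x => x ^ r * φ x) := by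
    refine ⟨?_, hφ.compact.mul_left, (tsupport_mul_subset_right).trans hφ.supp⟩
    rw [contDiff_iff_contDiffAt]
    intro x
    by_cases hx : x ∈ tsupport φ
    · exact (Real.contDiffAt_rpow_const_of_ne (hpos x (hφ.supp hx)).ne').mul hφ.smooth.contDiffAt
    · have : (fun x => x ^ r * φ x) =ᶠ[nhds x] fun _ => 0 := by
        filter_upwards [(isClosed_tsupport φ).isOpen_compl.mem_nhds hx] with y hy
        rw [image_eq_zero_of_notMem_tsupport hy, mul_zero]
      exact contDiffAt_const.congr_of_eventuallyEq this
  have hd : ∀ x ∈ Ioo b (b + 1), deriv (fun x => x ^ s * φ x) x =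
      s * (x ^ (s - 1) * φ x) + x ^ s * deriv φ x := by
    intro x hx
    have h1 := (Real.hasDerivAt_rpow_const (x := x) (p := s) (Or.inl (hpos x hx).ne'))
    have h2 := (hφ.smooth.differentiable (by simp) x).hasDerivAt
    have h3 : HasDerivAt (fun x => x ^ s * φ x) _ x := h1.mul h2
    rw [h3.deriv]
    ring
  have e1 : ∫ x in Ioo b (b + 1), ((deriv φ x : ℝ) : ℂ) * powOp hb s f x =
      (∫ x in Ioo b (b + 1), ((deriv (fun x => x ^ s * φ x) x : ℝ) : ℂ) * f x) -
        s * ∫ x in Ioo b (b + 1), ((x ^ (s - 1) * φ x : ℝ) : ℂ) * f x := by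
    rw [← integral_const_mul, ← integral_sub ((key s).deriv.integrable_mul f)
      (((key (s - 1)).integrable_mul f).const_mul _)]
    apply integral_congr_ae
    filter_upwards [coeFn_mulOp _ (memLp_rpow hb s) f, ae_restrict_mem measurableSet_Ioo]
      with x hx hxI
    rw [powOp, hx, hd x hxI]
    push_cast
    ring
  have e2 : ∫ x in Ioo b (b + 1), ((φ x : ℝ) : ℂ) *
        (powOp hb s g + (s : ℂ) • powOp hb (s - 1) f : L2 b) x =
      (∫ x in Ioo b (b + 1), ((x ^ s * φ x : ℝ) : ℂ) * g x) +
        s * ∫ x in Ioo b (b + 1), ((x ^ (s - 1) * φ x : ℝ) : ℂ) * f x := by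
    rw [← integral_const_mul, ← integral_add ((key s).integrable_mul g)
      (((key (s - 1)).integrable_mul f).const_mul _)]
    apply integral_congr_ae
    filter_upwards [coeFn_mulOp _ (memLp_rpow hb s) g, coeFn_mulOp _ (memLp_rpow hb (s - 1)) f,
      Lp.coeFn_add (powOp hb s g) ((s : ℂ) • powOp hb (s - 1) f),
      Lp.coeFn_smul (s : ℂ) (powOp hb (s - 1) f)] with x h1 h2 h3 h4
    rw [h3, Pi.add_apply, h4, Pi.smul_apply, powOp, powOp, h1, h2,
      smul_eq_mul]
    push_cast
    ring
  rw [e1, e2, h _ (key s)]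
  ring

/-! ### The form `h_b` and the operator `H_b` -/

theorem powOp_mem_domain {b : ℝ} (hb : 0 < b) (s : ℝ) (u : H2 b) :
    ((powOp hb s).comp (H2 b).subtype) u ∈ (weakD b).domain := by
  obtain ⟨u, u₁, u₂, h1, h2⟩ := u
  exact mem_domain_weakD.2 ⟨_, h1.rpowMul hb s⟩

/-- `u ↦ (x ^ (-β) u)'` on `H²(b, b + 1)`. -/
def firstOp {b : ℝ} (hb : 0 < b) (β : ℝ) : H2 b →ₗ[ℂ] L2 b :=
  (weakD b).toFun.comp
    (((powOp hb (-β)).comp (H2 b).subtype).codRestrict (weakD b).domain (powOp_mem_domain hb (-β)))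

theorem firstOp_mem_domain {b : ℝ} (hb : 0 < b) (α β : ℝ) (u : H2 b) :
    ((powOp hb (-α)).comp (firstOp hb β)) u ∈ (weakD b).domain := by
  obtain ⟨u, u₁, u₂, h1, h2⟩ := u
  have h3 : HasWeakDeriv (powOp hb (-β) u) (firstOp hb β ⟨u, u₁, u₂, h1, h2⟩) :=
    mem_graph_weakD.1 (LinearPMap.mem_graph (weakD b)
      ⟨powOp hb (-β) u, powOp_mem_domain hb (-β) ⟨u, u₁, u₂, h1, h2⟩⟩)
  have h4 : HasWeakDeriv (powOp hb (-β) u)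
      (powOp hb (-β) u₁ + ((-β : ℝ) : ℂ) • powOp hb (-β - 1) u) := h1.rpowMul hb (-β)
  have h5 := (weakD b).mem_graph_snd_inj (mem_graph_weakD.2 h3) (mem_graph_weakD.2 h4) rfl
  rw [LinearMap.comp_apply, h5]
  exact mem_domain_weakD.2
    ⟨_, ((h2.rpowMul hb (-β)).add ((h1.rpowMul hb (-β - 1)).smul _)).rpowMul hb (-α)⟩

/-- `u ↦ (x ^ (-α) (x ^ (-β) u)')'` on `H²(b, b + 1)`. -/
def secondOp {b : ℝ} (hb : 0 < b) (α β : ℝ) : H2 b →ₗ[ℂ] L2 b :=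
  (weakD b).toFun.comp
    (((powOp hb (-α)).comp (firstOp hb β)).codRestrict (weakD b).domain
      (firstOp_mem_domain hb α β))

/-- The sesquilinear form `h_b[u, v]` with domain `H²(b, b + 1)`, antilinear in `u`. -/
def form {b : ℝ} (hb : 0 < b) (α β : ℝ) (u v : H2 b) : ℂ :=
  ∫ x in Ioo b (b + 1),
    conj (secondOp hb α β u x) * secondOp hb α β v x * ((x ^ (2 * (α + β)) : ℝ) : ℂ)

theorem form_eq_inner {b : ℝ} (hb : 0 < b) (α β : ℝ) (u v : H2 b) :
    form hb α β u v =
      inner ℂ (secondOp hb α β u) (powOp hb (2 * (α + β)) (secondOp hb α β v)) := by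
  rw [L2.inner_def, form]
  apply integral_congr_ae
  filter_upwards [coeFn_mulOp _ (memLp_rpow hb (2 * (α + β))) (secondOp hb α β v)] with x hx
  rw [powOp, hx, RCLike.inner_apply]
  ring

/-- The graph of `H_b`: `u ∈ H²` and `h_b[v, u] = ⟨v, w⟩` for all `v ∈ H²`. -/
def opGraph {b : ℝ} (hb : 0 < b) (α β : ℝ) : Submodule ℂ (L2 b × L2 b) where
  carrier := {p | ∃ hu : p.1 ∈ H2 b, ∀ v : H2 b,
    form hb α β v ⟨p.1, hu⟩ = inner ℂ (v : L2 b) p.2}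
  add_mem' := by
    rintro ⟨u, w⟩ ⟨u', w'⟩ ⟨hu, h⟩ ⟨hu', h'⟩
    refine ⟨(H2 b).add_mem hu hu', fun v => ?_⟩
    have h1 := h v
    have h2 := h' v
    have e : (⟨u + u', (H2 b).add_mem hu hu'⟩ : H2 b) = ⟨u, hu⟩ + ⟨u', hu'⟩ := rfl
    simp only [form_eq_inner] at h1 h2 ⊢
    simp only [Prod.mk_add_mk, e, map_add, inner_add_right, h1, h2]
  zero_mem' := by
    refine ⟨(H2 b).zero_mem, fun v => ?_⟩
    have e : (⟨0, (H2 b).zero_mem⟩ : H2 b) = 0 := rfl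
    simp [form_eq_inner, e]
  smul_mem' := by
    rintro c ⟨u, w⟩ ⟨hu, h⟩
    refine ⟨(H2 b).smul_mem c hu, fun v => ?_⟩
    have h1 := h v
    have e : (⟨c • u, (H2 b).smul_mem c hu⟩ : H2 b) = c • ⟨u, hu⟩ := rfl
    simp only [form_eq_inner] at h1 ⊢
    simp only [Prod.smul_mk, e, map_smul, inner_smul_right, h1]

theorem IsTest.hasWeakDeriv {b : ℝ} {φ : ℝ → ℝ} (h : IsTest b φ) :
    HasWeakDeriv ((h.memLp 2).toLp : L2 b) ((h.deriv.memLp 2).toLp : L2 b) := by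
  intro ψ hψ
  have e (χ η : ℝ → ℝ) (hχ : IsTest b χ) (hη : MemLp (fun x => (η x : ℂ)) 2 (μ b)) :
      ∫ x in Ioo b (b + 1), ((χ x : ℝ) : ℂ) * (hη.toLp : L2 b) x =
        ((∫ x, χ x * η x : ℝ) : ℂ) := by
    rw [← integral_complex_ofReal, ← setIntegral_eq_integral_of_forall_compl_eq_zero
      (s := Ioo b (b + 1)) (f := fun x => ((χ x * η x : ℝ) : ℂ))]
    · apply integral_congr_ae
      filter_upwards [hη.coeFn_toLp] with x hx
      rw [hx]
      push_cast
      rfl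
    · intro x hx
      have : χ x = 0 := image_eq_zero_of_notMem_tsupport fun hx' => hx (hχ.supp hx')
      simp [this]
  rw [e _ _ hψ.deriv, e _ _ hψ, ← Complex.ofReal_neg]
  congr 1
  have hi (χ η : ℝ → ℝ) (hχ : IsTest b χ) (hη : IsTest b η) : Integrable (χ * η) :=
    (hχ.smooth.continuous.mul hη.smooth.continuous).integrable_of_hasCompactSupport
      hχ.compact.mul_right
  have hp := integral_mul_deriv_eq_deriv_mul_of_integrable
    (u := ψ) (v := φ) (u' := _root_.deriv ψ) (v' := _root_.deriv φ)
    (fun x _ => (hψ.smooth.differentiable (by simp) x).hasDerivAt)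
    (fun x _ => (h.smooth.differentiable (by simp) x).hasDerivAt)
    (hi _ _ hψ h.deriv) (hi _ _ hψ.deriv h) (hi _ _ hψ h)
  rw [hp, neg_neg]

/-- Since `H²(b, b + 1)` is dense in `L²(b, b + 1)`, the graph defines an operator. -/
theorem opGraph_functional {b : ℝ} (hb : 0 < b) (α β : ℝ) (p : L2 b × L2 b)
    (hp : p ∈ opGraph hb α β) (h0 : p.1 = 0) : p.2 = 0 := by
  obtain ⟨u, w⟩ := p
  obtain ⟨hu, h⟩ := hp
  obtain rfl : u = 0 := h0
  refine eq_zero_of_test _ fun φ hφ => ?_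
  have h1 := h ⟨(hφ.memLp 2).toLp, _, _, hφ.hasWeakDeriv, hφ.deriv.hasWeakDeriv⟩
  have e : (⟨0, hu⟩ : H2 b) = 0 := rfl
  simp only [form_eq_inner, e, map_zero, inner_zero_right] at h1
  rw [L2.inner_def] at h1
  rw [h1]
  apply integral_congr_ae
  filter_upwards [(hφ.memLp 2).coeFn_toLp] with x hx
  rw [hx, RCLike.inner_apply, Complex.conj_ofReal, mul_comm]

/-- `H_b`, the operator in `L²(b, b + 1)` associated with the form `h_b`. -/
def Hb {b : ℝ} (hb : 0 < b) (α β : ℝ) : L2 b →ₗ.[ℂ] L2 b := (opGraph hb α β).toLinearPMap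

theorem mem_graph_Hb {b : ℝ} (hb : 0 < b) (α β : ℝ) (u w : L2 b) :
    (u, w) ∈ (Hb hb α β).graph ↔
      ∃ hu : u ∈ H2 b, ∀ v : H2 b, form hb α β v ⟨u, hu⟩ = inner ℂ (v : L2 b) w := by
  rw [Hb, Submodule.toLinearPMap_graph_eq _ (opGraph_functional hb α β)]
  rfl

/-- `H_b - V` for a bounded potential `V`: the operator sum, with the domain of `H_b`. -/
def HbSub {b : ℝ} (hb : 0 < b) (α β : ℝ) (V : ℝ → ℝ) (hV : MemLp V ∞ (μ b)) :
    L2 b →ₗ.[ℂ] L2 b :=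
  Hb hb α β - (mulOp V hV).toPMap ⊤

/-! ### Spectrum of an unbounded operator -/

/-- `z` is in the resolvent set of `A`: `A - z` is a bijection from its domain onto the whole
space, with bounded inverse `R`. -/
def IsResolventPoint {X : Type*} [NormedAddCommGroup X] [NormedSpace ℂ X] (A : X →ₗ.[ℂ] X)
    (z : ℂ) : Prop :=
  ∃ R : X →L[ℂ] X,
    (∀ w : X, ∃ h : R w ∈ A.domain, A ⟨R w, h⟩ - z • R w = w) ∧
    ∀ u : A.domain, R (A u - z • (u : X)) = u

/-- The negative part of the spectrum of `A`. -/
def negSpectrum {X : Type*} [NormedAddCommGroup X] [NormedSpace ℂ X] (A : X →ₗ.[ℂ] X) : Set ℝ :=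
  {t | t < 0 ∧ ¬ IsResolventPoint A (t : ℂ)}

/-- The eigenspace `{u ∈ dom A : A u = z u}`. -/
def eigenspace {X : Type*} [NormedAddCommGroup X] [NormedSpace ℂ X] (A : X →ₗ.[ℂ] X) (z : ℂ) :
    Submodule ℂ X :=
  A.graph.comap (LinearMap.id.prod (z • LinearMap.id))

end IntervalOp

end

/-! The idea is to remove the unbounded operator. Integrating `(x^(-α) (x^(-β) u)')' = x^(-(α+β)) g`
twice gives `u = c₀ x^β + c₁ x^(α+β+1) + S g`, where `S` is an explicit double integral (`solL`).
Thus `u = J (c, g)` with `J` (`paramL`) bounded on `K = ℂ² ⊕ L²` and having range `H²`, and the form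
becomes `‖g‖² = ‖P (c, g)‖²` for the projection `P` onto the second summand, whose kernel has
dimension two. The weak equation `(H_b - V - t) u = w` turns into `B(t) k = J* w` with the bounded
symmetric operator `B(t) = P - J* (V + t) J` (`pencil`, `mem_graph_HbSub_iff`).

For the abstract pencil two facts decide the count. If `⟨Jk, V Jk⟩ ≤ ‖k‖²/2` on the range of `P`,
then for `t ≤ 0` the operator `B(t)` is a finite-rank perturbation of a coercive one, so the
negative spectrum consists of eigenvalues (`isUnit_pencil`); three mutually orthogonal eigenvectors
would have a nontrivial combination in the range of `P`, where the form is nonnegative, so there are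
at most two. If `⟨Jk, V Jk⟩ > 0` for nonzero `k` in `ker P`, the form is negative on a plane, and
minimizing the Rayleigh quotient, then deflating and minimizing again, produces two
(`exists_orthonormal_pencil`).

The analytic input consists of pointwise bounds uniform in `b`: `|S g(x)| ≤ C x^(ν/2) ‖g‖`
(`norm_solL_le`), and `|p(x)| ≤ C x^(ν/2) ‖p‖` for `p` in the span of the two powers
(`norm_kerFun_le`). Integrated against `V`, they give the coercivity and the lower bound on the
eigenvalues as soon as `∫ V x^ν` is small. Positivity on `ker P` holds because a nonzero such `p`
has at most one zero (`re_inner_mulL_pos`). -/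

namespace IntervalOp

/-! ### Finite-rank perturbations of invertible operators -/

open ContinuousLinearMap in
/-- An injective operator that differs from an invertible one by an operator of finite rank is
invertible. -/
theorem isUnit_of_injective_of_finiteRank {K : Type*} [NormedAddCommGroup K] [NormedSpace ℂ K]
    [CompleteSpace K] (B C : K →L[ℂ] K) (hC : IsUnit C) (hB : Function.Injective B)
    (U : Submodule ℂ K) [FiniteDimensional ℂ U] (hU : ∀ k, B k - C k ∈ U) : IsUnit B := by
  have hCb := isUnit_iff_bijective.1 hC
  rw [isUnit_iff_bijective]
  refine ⟨hB, ?_⟩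
  let e : K ≃ₗ[ℂ] K := LinearEquiv.ofBijective (C : K →ₗ[ℂ] K) hCb
  -- `T = C⁻¹ B` is the identity modulo the finite-dimensional space `U' = C⁻¹ U`. It therefore maps
  -- `U'` into itself, injectively and hence surjectively, and a preimage can be corrected inside
  -- `U'`.
  let U' : Submodule ℂ K := U.map (e.symm : K →ₗ[ℂ] K)
  let T : K →ₗ[ℂ] K := (e.symm : K →ₗ[ℂ] K) ∘ₗ (B : K →ₗ[ℂ] K)
  have hTe : ∀ k, T k - k ∈ U' := by
    intro k
    refine ⟨B k - C k, hU k, ?_⟩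
    have h1 : e.symm (C k) = k := e.symm_apply_apply k
    simp [T, h1]
  have hT : Function.Injective T := e.symm.injective.comp hB
  have hTU : ∀ k ∈ U', T k ∈ U' := fun k hk => by
    simpa using U'.add_mem (hTe k) hk
  have hs : Function.Surjective (T.restrict hTU) := by
    refine LinearMap.injective_iff_surjective.1 fun x y hxy => ?_
    exact Subtype.ext (hT (congrArg Subtype.val hxy))
  intro y
  obtain ⟨z, hz⟩ := hs ⟨T (e.symm y) - e.symm y, hTe _⟩
  have hz' : T z = T (e.symm y) - e.symm y := congrArg Subtype.val hz
  refine ⟨e.symm y - z, ?_⟩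
  apply e.symm.injective
  change T (e.symm y - z) = e.symm y
  rw [map_sub, hz']
  abel

/-! ### The abstract pencil: Fredholm alternative and counting of negative eigenvalues -/

section Pencil

variable {X K : Type*} [NormedAddCommGroup X] [InnerProductSpace ℂ X] [CompleteSpace X]
  [NormedAddCommGroup K] [InnerProductSpace ℂ K] [CompleteSpace K]

/-- The operator on `K` representing the form `⟨P k', P k⟩ - ⟨J k', (W + t) J k⟩`. -/
noncomputable def pencil (P : K →L[ℂ] K) (J : K →L[ℂ] X) (W : X →L[ℂ] X) (t : ℝ) : K →L[ℂ] K :=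
  P - J.adjoint ∘L (W + (t : ℂ) • ContinuousLinearMap.id ℂ X) ∘L J

variable {P : K →L[ℂ] K} {J : K →L[ℂ] X} {W : X →L[ℂ] X}

theorem pencil_apply (t : ℝ) (k : K) :
    pencil P J W t k = P k - J.adjoint (W (J k) + (t : ℂ) • J k) := by
  simp [pencil]

theorem inner_pencil_right (t : ℝ) (k k' : K) :
    inner ℂ k' (pencil P J W t k) =
      inner ℂ k' (P k) - inner ℂ (J k') (W (J k)) - t * inner ℂ (J k') (J k) := by
  rw [pencil_apply, inner_sub_right, ContinuousLinearMap.adjoint_inner_right, inner_add_right,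
    inner_smul_right]
  ring

theorem pencil_symm (hP : (P : K →ₗ[ℂ] K).IsSymmetric) (hW : (W : X →ₗ[ℂ] X).IsSymmetric) (t : ℝ) :
    ((pencil P J W t : K →L[ℂ] K) : K →ₗ[ℂ] K).IsSymmetric := by
  intro x y
  have h1 := hP x y
  have h2 := hW (J x) (J y)
  simp only [ContinuousLinearMap.coe_coe] at h1 h2 ⊢
  rw [inner_pencil_right, ← inner_conj_symm, inner_pencil_right]
  simp only [map_sub, map_mul, inner_conj_symm, h1, h2, Complex.conj_ofReal]

theorem re_inner_proj {K : Type*} [NormedAddCommGroup K] [InnerProductSpace ℂ K]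
    {P : K →L[ℂ] K} (hP : (P : K →ₗ[ℂ] K).IsSymmetric) (hPP : ∀ k, P (P k) = P k) (k : K) :
    (inner ℂ k (P k)).re = ‖P k‖ ^ 2 := by
  have h1 := hP k (P k)
  simp only [ContinuousLinearMap.coe_coe, hPP] at h1
  rw [← h1, inner_self_eq_norm_sq_to_K]
  norm_cast

theorem re_inner_pencil (hP : (P : K →ₗ[ℂ] K).IsSymmetric) (hPP : ∀ k, P (P k) = P k)
    (t : ℝ) (k : K) :
    (inner ℂ k (pencil P J W t k)).re =
      ‖P k‖ ^ 2 - (inner ℂ (J k) (W (J k))).re - t * ‖J k‖ ^ 2 := by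
  have h : (inner ℂ (J k) (J k) : ℂ) = ((‖J k‖ ^ 2 : ℝ) : ℂ) := by
    rw [inner_self_eq_norm_sq_to_K]; norm_cast
  rw [inner_pencil_right, Complex.sub_re, Complex.sub_re, re_inner_proj hP hPP, h,
    Complex.re_ofReal_mul, Complex.ofReal_re]

/-- If the form is coercive on the range of `P`, and `ker P` is finite dimensional, then the
Fredholm alternative holds for the pencil. -/
theorem isUnit_pencil (hP : (P : K →ₗ[ℂ] K).IsSymmetric) (hPP : ∀ k, P (P k) = P k)
    [FiniteDimensional ℂ (LinearMap.ker (P : K →ₗ[ℂ] K))]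
    (hc : ∀ k, P k = k → (inner ℂ (J k) (W (J k))).re ≤ 1 / 2 * ‖k‖ ^ 2) {t : ℝ} (ht : t ≤ 0)
    (hi : Function.Injective (pencil P J W t)) : IsUnit (pencil P J W t) := by
  set B := pencil P J W t with hB
  set Q : K →L[ℂ] K := ContinuousLinearMap.id ℂ K - P with hQ
  have hQk : ∀ k, Q k ∈ LinearMap.ker (P : K →ₗ[ℂ] K) := fun k => by
    simp [hQ, hPP]
  -- `C` keeps the coercive block of `B` on the range of `P` and puts the identity on `ker P`. It is
  -- coercive with constant `1/2`, and `B - C = Q B - Q + P B Q` has finite rank because `Q` maps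
  -- into `ker P`.
  let C : K →L[ℂ] K := P ∘L B ∘L P + Q
  have hCu : IsUnit C := by
    refine ContinuousLinearMap.isUnit_of_forall_le_norm_inner_map C (c := 1 / 2) (by norm_num) ?_
    intro k
    have h1 : (inner ℂ k (C k)).re = (inner ℂ (P k) (B (P k))).re + (inner ℂ k (Q k)).re := by
      have := hP k (B (P k))
      simp only [ContinuousLinearMap.coe_coe] at this
      simp only [C, add_apply, ContinuousLinearMap.comp_apply,
        inner_add_right, Complex.add_re, this]
    have h2 : (inner ℂ k (Q k)).re = ‖k‖ ^ 2 - ‖P k‖ ^ 2 := by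
      have h : (inner ℂ k k : ℂ) = ((‖k‖ ^ 2 : ℝ) : ℂ) := by
        rw [inner_self_eq_norm_sq_to_K]; norm_cast
      rw [hQ, sub_apply, inner_sub_right, Complex.sub_re,
        re_inner_proj hP hPP, ContinuousLinearMap.id_apply, h, Complex.ofReal_re]
    have h3 := re_inner_pencil (J := J) (W := W) hP hPP t (P k)
    rw [hPP] at h3
    have h4 := hc (P k) (hPP k)
    have h5 : ‖P k‖ ^ 2 ≤ ‖k‖ ^ 2 := by
      have := re_inner_proj hP hPP k
      have h6 := (Complex.re_le_norm (inner ℂ k (P k))).trans (norm_inner_le_norm k (P k))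
      rw [this] at h6
      nlinarith [norm_nonneg k, norm_nonneg (P k)]
    have h6 : 1 / 2 * ‖k‖ ^ 2 ≤ (inner ℂ k (C k)).re := by
      rw [h1, h2, hB, h3]
      nlinarith [sq_nonneg ‖J (P k)‖]
    rw [← norm_inner_symm]
    refine le_trans ?_ (h6.trans (Complex.re_le_norm _))
    simp only [NNReal.coe_div, NNReal.coe_one, NNReal.coe_ofNat]
    linarith
  let N := LinearMap.ker (P : K →ₗ[ℂ] K)
  refine isUnit_of_injective_of_finiteRank B C hCu hi
    (N ⊔ N.map (P ∘L B : K →L[ℂ] K).toLinearMap) fun k => ?_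
  have : B k - C k = (Q (B k) - Q k) + P (B (Q k)) := by
    simp only [C, hQ, add_apply, ContinuousLinearMap.comp_apply,
      sub_apply, ContinuousLinearMap.id_apply, map_sub]
    abel
  rw [this]
  exact Submodule.add_mem_sup (N.sub_mem (hQk _) (hQk _)) ⟨Q k, hQk k, rfl⟩

/-- Evaluate the nonnegative form of `B` at `k - M⁻¹ B k` and bound the quadratic term by `‖B‖ ≤ M`.
For invertible `B` this upgrades nonnegativity to strict positivity of the form. -/
theorem norm_sq_le_of_nonneg {K : Type*} [NormedAddCommGroup K] [InnerProductSpace ℂ K]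
    {B : K →L[ℂ] K} (hB : (B : K →ₗ[ℂ] K).IsSymmetric)
    (h0 : ∀ k, 0 ≤ (inner ℂ k (B k)).re) {M : ℝ} (hM : ‖B‖ ≤ M) (hM0 : 0 < M) (k : K) :
    ‖B k‖ ^ 2 ≤ M * (inner ℂ k (B k)).re := by
  have h1 := h0 (k - ((M⁻¹ : ℝ) : ℂ) • B k)
  have e1 : (inner ℂ (B k) (B k) : ℂ) = ((‖B k‖ ^ 2 : ℝ) : ℂ) := by
    rw [inner_self_eq_norm_sq_to_K]; norm_cast
  have e2 : inner ℂ k (B (B k)) = inner ℂ (B k) (B k) := (hB k (B k)).symm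
  have e3 : (inner ℂ (B k) (B (B k))).re ≤ M * ‖B k‖ ^ 2 := by
    refine (Complex.re_le_norm _).trans ((norm_inner_le_norm _ _).trans ?_)
    have := (B.le_opNorm (B k)).trans (mul_le_mul_of_nonneg_right hM (norm_nonneg _))
    nlinarith [norm_nonneg (B k)]
  simp only [map_sub, map_smul, inner_sub_left, inner_sub_right, inner_smul_left,
    inner_smul_right, e2, e1, Complex.sub_re, Complex.conj_ofReal, Complex.re_ofReal_mul,
    Complex.ofReal_re] at h1
  have h2 : M⁻¹ * (M⁻¹ * (inner ℂ (B k) (B (B k))).re) ≤ M⁻¹ * ‖B k‖ ^ 2 := by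
    have : M⁻¹ * (inner ℂ (B k) (B (B k))).re ≤ ‖B k‖ ^ 2 := by
      rw [inv_mul_le_iff₀ hM0]; exact e3
    exact mul_le_mul_of_nonneg_left this (inv_nonneg.2 hM0.le)
  have h3 : M⁻¹ * ‖B k‖ ^ 2 ≤ (inner ℂ k (B k)).re := by linarith
  rwa [inv_mul_le_iff₀ hM0] at h3

/-- If the form takes negative values, then its infimum on the unit sphere of `X` is an
eigenvalue. -/
theorem exists_ground_state (hP : (P : K →ₗ[ℂ] K).IsSymmetric) (hPP : ∀ k, P (P k) = P k)
    [FiniteDimensional ℂ (LinearMap.ker (P : K →ₗ[ℂ] K))]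
    (hW : (W : X →ₗ[ℂ] X).IsSymmetric)
    (hc : ∀ k, P k = k → (inner ℂ (J k) (W (J k))).re ≤ 1 / 2 * ‖k‖ ^ 2)
    (hneg : ∃ k, ‖P k‖ ^ 2 < (inner ℂ (J k) (W (J k))).re) :
    ∃ t : ℝ, t < 0 ∧ ∃ k, k ≠ 0 ∧ pencil P J W t k = 0 := by
  have hlow : ∀ k, (inner ℂ (J k) (W (J k))).re ≤ ‖W‖ * ‖J k‖ ^ 2 := fun k => by
    refine (Complex.re_le_norm _).trans ((norm_inner_le_norm _ _).trans ?_)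
    have := W.le_opNorm (J k)
    nlinarith [norm_nonneg (J k)]
  -- the set of all lower bounds of the Rayleigh quotient
  let S : Set ℝ := {m | ∀ k, m * ‖J k‖ ^ 2 ≤ ‖P k‖ ^ 2 - (inner ℂ (J k) (W (J k))).re}
  have hSne : S.Nonempty := ⟨-‖W‖, fun k => by nlinarith [hlow k, sq_nonneg ‖P k‖]⟩
  obtain ⟨k₀, hk₀⟩ := hneg
  have hJ0 : 0 < ‖J k₀‖ ^ 2 := by
    rcases (sq_nonneg ‖J k₀‖).lt_or_eq with h | h
    · exact h
    · have := hlow k₀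
      rw [← h] at this
      nlinarith [sq_nonneg ‖P k₀‖]
  have hSb : ∀ m ∈ S, m ≤ (‖P k₀‖ ^ 2 - (inner ℂ (J k₀) (W (J k₀))).re) / ‖J k₀‖ ^ 2 :=
    fun m hm => (le_div_iff₀ hJ0).2 (hm k₀)
  have hSbdd : BddAbove S := ⟨_, hSb⟩
  have hmS : sSup S ∈ S := by
    intro k
    rcases (sq_nonneg ‖J k‖).lt_or_eq with h | h
    · rw [← le_div_iff₀ h]
      exact csSup_le hSne fun m hm => (le_div_iff₀ h).2 (hm k)
    · have := hlow k
      rw [← h] at this ⊢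
      nlinarith [sq_nonneg ‖P k‖]
  set m := sSup S with hm
  have hm0 : m < 0 :=
    (csSup_le hSne hSb).trans_lt (div_neg_of_neg_of_pos (by linarith) hJ0)
  refine ⟨m, hm0, ?_⟩
  -- If `m` were not an eigenvalue, the pencil at `m` would be invertible with a nonnegative form,
  -- so the form would dominate a multiple `L⁻¹` of `‖J k‖²`. Then `m + L⁻¹` would still be a lower
  -- bound, contradicting the choice of `m` as supremum.
  by_contra! hcon
  have hi : Function.Injective (pencil P J W m) := by
    rw [injective_iff_map_eq_zero]
    intro k hk
    by_contra hk0
    exact hcon k hk0 hk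
  have hu := isUnit_pencil hP hPP hc hm0.le hi
  set B := pencil P J W m with hB
  obtain ⟨R, hR⟩ : ∃ R : K →L[ℂ] K, ∀ k, R (B k) = k := by
    obtain ⟨v, hv⟩ := hu
    refine ⟨↑v⁻¹, fun k => ?_⟩
    rw [← hv, ← mul_apply_eq_comp, Units.inv_mul, one_apply_eq_self]
  have hpos : ∀ k, 0 ≤ (inner ℂ k (B k)).re := fun k => by
    rw [hB, re_inner_pencil hP hPP]
    linarith [hmS k]
  have key := fun k => norm_sq_le_of_nonneg (pencil_symm (J := J) hP hW m) hpos
    (M := ‖B‖ + 1) (by linarith) (by positivity) k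
  set L := (‖J‖ * ‖R‖) ^ 2 * (‖B‖ + 1) + 1 with hL
  have hL0 : 0 < L := by positivity
  have hJB : ∀ k, ‖J k‖ ^ 2 ≤ L * (inner ℂ k (B k)).re := by
    intro k
    have h1 : ‖J k‖ ≤ ‖J‖ * ‖R‖ * ‖B k‖ := by
      have h2 := R.le_opNorm (B k)
      rw [hR] at h2
      refine (J.le_opNorm k).trans ?_
      rw [mul_assoc]
      exact mul_le_mul_of_nonneg_left h2 (norm_nonneg _)
    calc ‖J k‖ ^ 2 ≤ (‖J‖ * ‖R‖ * ‖B k‖) ^ 2 := pow_le_pow_left₀ (norm_nonneg _) h1 2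
      _ = (‖J‖ * ‖R‖) ^ 2 * ‖B k‖ ^ 2 := by ring
      _ ≤ (‖J‖ * ‖R‖) ^ 2 * ((‖B‖ + 1) * (inner ℂ k (B k)).re) :=
        mul_le_mul_of_nonneg_left (key k) (sq_nonneg _)
      _ ≤ L * (inner ℂ k (B k)).re := by
        rw [hL]
        nlinarith [hpos k]
  have hmem : m + L⁻¹ ∈ S := by
    intro k
    have h1 := hJB k
    rw [← inv_mul_le_iff₀ hL0, hB, re_inner_pencil hP hPP] at h1
    linarith
  have := le_csSup hSbdd hmem
  have hLi := inv_pos.2 hL0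
  linarith

/-- Pair each equation with the other vector: by symmetry of `P` and `W` the difference is `(t - s)
⟨J k, J k'⟩`. Orthogonality holds in `X`, not in `K`. -/
theorem inner_eq_zero_of_pencil (hP : (P : K →ₗ[ℂ] K).IsSymmetric)
    (hW : (W : X →ₗ[ℂ] X).IsSymmetric) {s t : ℝ} (hst : s ≠ t) {k k' : K}
    (hk : pencil P J W s k = 0) (hk' : pencil P J W t k' = 0) : inner ℂ (J k) (J k') = 0 := by
  have h1 := inner_pencil_right (P := P) (J := J) (W := W) t k' k
  have h2 := inner_pencil_right (P := P) (J := J) (W := W) s k k'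
  rw [hk', inner_zero_right] at h1
  rw [hk, inner_zero_right] at h2
  have h3 := congrArg conj h2
  have h4 := hP k k'
  have h5 := hW (J k) (J k')
  simp only [ContinuousLinearMap.coe_coe] at h4 h5
  simp only [map_zero, map_sub, map_mul, inner_conj_symm, h4, h5, Complex.conj_ofReal] at h3
  have h6 : ((t : ℂ) - s) * inner ℂ (J k) (J k') = 0 := by linear_combination h1 - h3
  rcases mul_eq_zero.1 h6 with h | h
  · exact absurd (by exact_mod_cast (sub_eq_zero.1 h).symm) hst
  · exact h

/-- There are at most two negative eigenvalues if `ker P` has dimension two. -/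
theorem exists_eq_zero_of_pairwise_orthogonal (hP : (P : K →ₗ[ℂ] K).IsSymmetric)
    (hPP : ∀ k, P (P k) = P k) [FiniteDimensional ℂ (LinearMap.ker (P : K →ₗ[ℂ] K))]
    (hfin : Module.finrank ℂ (LinearMap.ker (P : K →ₗ[ℂ] K)) = 2)
    (hc : ∀ k, P k = k → (inner ℂ (J k) (W (J k))).re ≤ 1 / 2 * ‖k‖ ^ 2)
    (t : Fin 3 → ℝ) (ht : ∀ i, t i < 0) (k : Fin 3 → K)
    (hk : ∀ i, pencil P J W (t i) (k i) = 0)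
    (ho : Pairwise fun i j => inner ℂ (J (k i)) (J (k j)) = 0) : ∃ i, J (k i) = 0 := by
  let Q : K →ₗ[ℂ] LinearMap.ker (P : K →ₗ[ℂ] K) :=
    (LinearMap.id - (P : K →ₗ[ℂ] K)).codRestrict _ fun x => by simp [hPP]
  let f : (Fin 3 → ℂ) →ₗ[ℂ] LinearMap.ker (P : K →ₗ[ℂ] K) :=
    Q ∘ₗ Fintype.linearCombination ℂ k
  -- Three vectors projected to a plane are dependent, so some nontrivial combination `x` satisfies
  -- `P x = x`. There the form is nonnegative, whereas orthogonality diagonalizes it to `∑ tᵢ |cᵢ|²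
  -- ‖J kᵢ‖²`, which is negative if no `J kᵢ` vanishes.
  have hker : LinearMap.ker f ≠ ⊥ := LinearMap.ker_ne_bot_of_finrank_lt (by simp [hfin])
  obtain ⟨c, hc0, hcne⟩ := (Submodule.ne_bot_iff _).1 hker
  set x := Fintype.linearCombination ℂ k c with hx
  have hxs : x = ∑ i, c i • k i := Fintype.linearCombination_apply ℂ k c
  have hPx : P x = x := by
    have h1 : Q x = 0 := hc0
    have h2 : x - P x = 0 := congrArg Subtype.val h1
    exact (sub_eq_zero.1 h2).symm
  have hself : ∀ i, (inner ℂ x (pencil P J W 0 (k i))) =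
      t i * (conj (c i) * ((‖J (k i)‖ ^ 2 : ℝ) : ℂ)) := by
    intro i
    have h1 := inner_pencil_right (P := P) (J := J) (W := W) (t i) (k i) x
    rw [hk i, inner_zero_right] at h1
    rw [inner_pencil_right]
    have h2 : inner ℂ (J x) (J (k i)) = conj (c i) * ((‖J (k i)‖ ^ 2 : ℝ) : ℂ) := by
      rw [hxs, map_sum, sum_inner, Finset.sum_eq_single i]
      · rw [map_smul, inner_smul_left, inner_self_eq_norm_sq_to_K]
        norm_cast
      · intro j _ hj
        rw [map_smul, inner_smul_left, ho hj, mul_zero]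
      · simp
    rw [← h2]
    push_cast
    linear_combination -h1
  have hval : (inner ℂ x (pencil P J W 0 x)).re = ∑ i, t i * (‖c i‖ ^ 2 * ‖J (k i)‖ ^ 2) := by
    have e : pencil P J W 0 x = ∑ i, c i • pencil P J W 0 (k i) := by
      rw [hxs, map_sum]
      simp only [map_smul]
    rw [e, inner_sum, Complex.re_sum]
    refine Finset.sum_congr rfl fun i _ => ?_
    rw [inner_smul_right, hself i]
    have : c i * (t i * (conj (c i) * ((‖J (k i)‖ ^ 2 : ℝ) : ℂ))) =
        ((t i * (‖c i‖ ^ 2 * ‖J (k i)‖ ^ 2) : ℝ) : ℂ) := by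
      have h := Complex.mul_conj' (c i)
      push_cast
      linear_combination (t i : ℂ) * (‖J (k i)‖ : ℂ) ^ 2 * h
    rw [this, Complex.ofReal_re]
  have hnn : 0 ≤ (inner ℂ x (pencil P J W 0 x)).re := by
    rw [re_inner_pencil hP hPP, hPx]
    have := hc x hPx
    nlinarith [sq_nonneg ‖x‖]
  by_contra! hne
  obtain ⟨i, hi⟩ : ∃ i, c i ≠ 0 := by
    by_contra! h
    exact hcne (funext h)
  have hlt : ∑ i, t i * (‖c i‖ ^ 2 * ‖J (k i)‖ ^ 2) < 0 := by
    refine Finset.sum_neg' (fun j _ => ?_) ⟨i, Finset.mem_univ i, ?_⟩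
    · exact mul_nonpos_of_nonpos_of_nonneg (ht j).le (by positivity)
    · have h1 := norm_pos_iff.2 hi
      have h2 := norm_pos_iff.2 (hne i)
      exact mul_neg_of_neg_of_pos (ht i) (by positivity)
  linarith

/-- An eigenvector of the pencil does not vanish under `J`. -/
theorem apply_ne_zero_of_pencil (hN : ∀ k, P k = 0 → k ≠ 0 → 0 < (inner ℂ (J k) (W (J k))).re)
    {W' : X →L[ℂ] X} {t : ℝ} {k : K} (hk0 : k ≠ 0) (hk : pencil P J W' t k = 0) : J k ≠ 0 := by
  intro h
  rw [pencil_apply, h] at hk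
  have hPk : P k = 0 := by simpa using hk
  have := hN k hPk hk0
  rw [h] at this
  simp at this

/-- Existence of two orthonormal eigenvectors with negative eigenvalues. -/
theorem exists_orthonormal_pencil (hP : (P : K →ₗ[ℂ] K).IsSymmetric) (hPP : ∀ k, P (P k) = P k)
    [FiniteDimensional ℂ (LinearMap.ker (P : K →ₗ[ℂ] K))]
    (hfin : Module.finrank ℂ (LinearMap.ker (P : K →ₗ[ℂ] K)) = 2)
    (hW : (W : X →ₗ[ℂ] X).IsSymmetric)
    (hc : ∀ k, P k = k → (inner ℂ (J k) (W (J k))).re ≤ 1 / 2 * ‖k‖ ^ 2)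
    (hN : ∀ k, P k = 0 → k ≠ 0 → 0 < (inner ℂ (J k) (W (J k))).re) :
    ∃ (t : Fin 2 → ℝ) (k : Fin 2 → K), (∀ i, t i < 0) ∧ (∀ i, pencil P J W (t i) (k i) = 0) ∧
      Orthonormal ℂ fun i => J (k i) := by
  have hnorm : ∀ {t : ℝ} {k : K}, pencil P J W t k = 0 → J k ≠ 0 →
      pencil P J W t (((‖J k‖⁻¹ : ℝ) : ℂ) • k) = 0 ∧ ‖J (((‖J k‖⁻¹ : ℝ) : ℂ) • k)‖ = 1 := by
    intro t k h h0
    refine ⟨by rw [map_smul, h, smul_zero], ?_⟩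
    rw [map_smul, norm_smul, Complex.norm_real, norm_inv, norm_norm,
      inv_mul_cancel₀ (norm_ne_zero_iff.2 h0)]
  obtain ⟨t₁, ht₁, y₁, hy₁, hB₁⟩ := exists_ground_state hP hPP hW hc (by
    obtain ⟨v, hv⟩ := (Module.finrank_pos_iff_exists_ne_zero
      (R := ℂ) (M := LinearMap.ker (P : K →ₗ[ℂ] K))).1 (by omega)
    have hPv : P v = 0 := v.2
    refine ⟨v, ?_⟩
    rw [hPv, norm_zero]
    simpa using hN v hPv (by simpa using hv))
  obtain ⟨hk₁, hn₁⟩ := hnorm hB₁ (apply_ne_zero_of_pencil hN hy₁ hB₁)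
  set k₁ := ((‖J y₁‖⁻¹ : ℝ) : ℂ) • y₁
  -- move the first eigenvalue to zero
  let φ := J k₁
  let W' : X →L[ℂ] X := W + (t₁ : ℂ) • InnerProductSpace.rankOne ℂ φ φ
  have hW'a : ∀ x, W' x = W x + (t₁ : ℂ) • (inner ℂ φ x • φ) := fun x => by
    simp [W', InnerProductSpace.rankOne_apply]
  have hW'i : ∀ x y, inner ℂ x (W' y) = inner ℂ x (W y) + t₁ * (inner ℂ φ y * inner ℂ x φ) := by
    intro x y
    rw [hW'a, inner_add_right, inner_smul_right, inner_smul_right]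
  have hW's : (W' : X →ₗ[ℂ] X).IsSymmetric := by
    intro x y
    have h := hW x y
    simp only [ContinuousLinearMap.coe_coe] at h ⊢
    rw [hW'i, ← inner_conj_symm (W' x) y, hW'i, map_add, inner_conj_symm, h, map_mul, map_mul,
      inner_conj_symm, inner_conj_symm, Complex.conj_ofReal]
    ring
  have hW'le : ∀ x, (inner ℂ x (W' x)).re = (inner ℂ x (W x)).re + t₁ * ‖inner ℂ φ x‖ ^ 2 := by
    intro x
    have h : inner ℂ φ x * inner ℂ x φ = ((‖inner ℂ φ x‖ ^ 2 : ℝ) : ℂ) := by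
      rw [← inner_conj_symm x φ, Complex.mul_conj']
      push_cast
      rfl
    rw [hW'i, Complex.add_re, h, Complex.re_ofReal_mul, Complex.ofReal_re]
  obtain ⟨t₂, ht₂, y₂, hy₂, hB₂⟩ := exists_ground_state (J := J) (W := W') hP hPP hW's
    (fun k hk => by
      rw [hW'le]
      have := hc k hk
      have h2 := mul_nonpos_of_nonpos_of_nonneg ht₁.le (sq_nonneg ‖inner ℂ φ (J k)‖)
      linarith) (by
    -- One linear condition on the plane `ker P` leaves a nonzero vector whose image is orthogonal
    -- to `φ`. On it the quadratic forms of `W'` and `W` agree, so the deflated form still takes a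
    -- negative value.
    let f : LinearMap.ker (P : K →ₗ[ℂ] K) →ₗ[ℂ] ℂ :=
      ((innerSL ℂ φ ∘L J : K →L[ℂ] ℂ) : K →ₗ[ℂ] ℂ) ∘ₗ Submodule.subtype _
    have hker : LinearMap.ker f ≠ ⊥ := LinearMap.ker_ne_bot_of_finrank_lt (by simp [hfin])
    obtain ⟨v, hv0, hv⟩ := (Submodule.ne_bot_iff _).1 hker
    have hPv : P v = 0 := v.2
    have hfv : inner ℂ φ (J v) = 0 := hv0
    refine ⟨v, ?_⟩
    rw [hPv, norm_zero, hW'le, hfv]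
    simpa using hN v hPv (by simpa using hv))
  have hJ₂ := apply_ne_zero_of_pencil hN hy₂ hB₂
  -- After deflation `φ` belongs to the eigenvalue `0`, and `t₂ < 0` is different. Orthogonality to
  -- `φ` then makes the rank-one term vanish, so `y₂` solves the original eigenvalue equation as
  -- well.
  have horth : inner ℂ φ (J y₂) = 0 := by
    have h1 := inner_pencil_right (P := P) (J := J) (W := W') t₂ y₂ k₁
    rw [hB₂, inner_zero_right, hW'i] at h1
    have h2 := inner_pencil_right (P := P) (J := J) (W := W) t₁ k₁ y₂
    rw [hk₁, inner_zero_right] at h2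
    have h3 := congrArg conj h2
    have h4 := hP k₁ y₂
    have h5 := hW (J k₁) (J y₂)
    simp only [ContinuousLinearMap.coe_coe] at h4 h5
    simp only [map_zero, map_sub, map_mul, inner_conj_symm, h4, h5, Complex.conj_ofReal] at h3
    have h6 : inner ℂ (J k₁) φ = (1 : ℂ) := by
      rw [inner_self_eq_norm_sq_to_K, hn₁]
      simp
    rw [h6] at h1
    have h7 : (t₂ : ℂ) * inner ℂ φ (J y₂) = 0 := by
      change _ = _ - (_ + _ * (inner ℂ (J k₁) (J y₂) * _)) - _ at h1
      change _ * inner ℂ (J k₁) (J y₂) = _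
      linear_combination h1 - h3
    rcases mul_eq_zero.1 h7 with h | h
    · exact absurd (by exact_mod_cast h) ht₂.ne
    · exact h
  have hB₂' : pencil P J W t₂ y₂ = 0 := by
    rw [← hB₂, pencil_apply, pencil_apply, hW'a, horth, zero_smul, smul_zero, add_zero]
  obtain ⟨hk₂, hn₂⟩ := hnorm hB₂' hJ₂
  set k₂ := ((‖J y₂‖⁻¹ : ℝ) : ℂ) • y₂
  have ho : inner ℂ (J k₁) (J k₂) = 0 := by
    have e : J k₂ = ((‖J y₂‖⁻¹ : ℝ) : ℂ) • J y₂ := map_smul J _ _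
    rw [e, inner_smul_right]
    exact mul_eq_zero_of_right _ horth
  refine ⟨![t₁, t₂], ![k₁, k₂], ?_, ?_, ?_, ?_⟩
  · simp [Fin.forall_fin_two, ht₁, ht₂]
  · simp [Fin.forall_fin_two, hk₁, hk₂]
  · simp [Fin.forall_fin_two, hn₁, hn₂]
  · have ho' : inner ℂ (J k₂) (J k₁) = 0 := by rw [← inner_conj_symm, ho, map_zero]
    intro i j hij
    fin_cases i <;> fin_cases j
    · exact absurd rfl hij
    · exact ho
    · exact ho'
    · exact absurd rfl hij

/-! ### From the pencil to the spectrum of the unbounded operator -/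

/-- The negative spectrum of an operator given by a form that is coercive on a subspace of
codimension two and negative on a complement of it. -/
theorem exists_negSpectrum_eq (hP : (P : K →ₗ[ℂ] K).IsSymmetric) (hPP : ∀ k, P (P k) = P k)
    [FiniteDimensional ℂ (LinearMap.ker (P : K →ₗ[ℂ] K))]
    (hfin : Module.finrank ℂ (LinearMap.ker (P : K →ₗ[ℂ] K)) = 2)
    (hW : (W : X →ₗ[ℂ] X).IsSymmetric)
    (hc : ∀ k, P k = k → (inner ℂ (J k) (W (J k))).re ≤ 1 / 2 * ‖k‖ ^ 2)
    (hN : ∀ k, P k = 0 → k ≠ 0 → 0 < (inner ℂ (J k) (W (J k))).re)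
    {E : ℝ} (hE : ∀ k, (inner ℂ (J k) (W (J k))).re ≤ ‖P k‖ ^ 2 + E * ‖J k‖ ^ 2)
    (A : X →ₗ.[ℂ] X)
    (hA : ∀ u w, (u, w) ∈ A.graph ↔ ∃ k, J k = u ∧ pencil P J W 0 k = J.adjoint w) :
    ∃ E₁ E₂ : ℝ, 0 < E₁ ∧ 0 < E₂ ∧ E₁ ≤ E ∧ E₂ ≤ E ∧ negSpectrum A = {-E₁, -E₂} ∧
      ∀ t : ℝ, t < 0 → Module.rank ℂ (eigenspace A (t : ℂ)) =
        (if t = -E₁ then 1 else 0) + (if t = -E₂ then 1 else 0) := by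
  obtain ⟨t, k, ht, hk, ho⟩ := exists_orthonormal_pencil hP hPP hfin hW hc hN
  have hpen : ∀ (s : ℝ) (k : K),
      pencil P J W s k = pencil P J W 0 k - (s : ℂ) • J.adjoint (J k) := by
    intro s k
    simp only [pencil_apply, map_add, map_smul, Complex.ofReal_zero, zero_smul, add_zero]
    abel
  have hmem : ∀ (s : ℝ) (u : X),
      u ∈ eigenspace A (s : ℂ) ↔ ∃ k, J k = u ∧ pencil P J W s k = 0 := by
    intro s u
    have : u ∈ eigenspace A (s : ℂ) ↔ (u, (s : ℂ) • u) ∈ A.graph := Iff.rfl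
    rw [this, hA]
    refine exists_congr fun k => and_congr_right fun hu => ?_
    rw [hpen s, sub_eq_zero, map_smul, hu]
  -- an eigenvector orthogonal to both vanishes
  have hzero : ∀ (s : ℝ) (u : X), s < 0 → u ∈ eigenspace A (s : ℂ) →
      (∀ i, inner ℂ (J (k i)) u = 0) → u = 0 := by
    intro s u hs hu hui
    obtain ⟨x, rfl, hx⟩ := (hmem s u).1 hu
    obtain ⟨i, hi⟩ := exists_eq_zero_of_pairwise_orthogonal (J := J) (W := W) hP hPP hfin hc
      ![t 0, t 1, s]
      (by simp [Fin.forall_fin_succ, ht, hs]) ![k 0, k 1, x]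
      (by simp [Fin.forall_fin_succ, hk, hx]) (by
        have h01 : inner ℂ (J (k 0)) (J (k 1)) = 0 := ho.2 (by decide)
        have h10 : inner ℂ (J (k 1)) (J (k 0)) = 0 := ho.2 (by decide)
        have h0 := hui 0
        have h1 := hui 1
        have h0' : inner ℂ (J x) (J (k 0)) = 0 := by rw [← inner_conj_symm, h0, map_zero]
        have h1' : inner ℂ (J x) (J (k 1)) = 0 := by rw [← inner_conj_symm, h1, map_zero]
        intro i j hij
        fin_cases i <;> fin_cases j <;> first | exact absurd rfl hij | simpa)
    have hn0 : J (k 0) ≠ 0 := fun h => by simpa [h] using ho.1 0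
    have hn1 : J (k 1) ≠ 0 := fun h => by simpa [h] using ho.1 1
    fin_cases i
    · exact absurd hi hn0
    · exact absurd hi hn1
    · exact hi
  have hspan : ∀ s : ℝ, s < 0 → eigenspace A (s : ℂ) =
      Submodule.span ℂ (Set.range fun i : {i : Fin 2 // s = t i} => J (k i)) := by
    intro s hs
    apply le_antisymm
    · intro u hu
      -- `v` is the projection of `u` to the known eigenvectors with eigenvalue `s`. The remainder
      -- is orthogonal to these by construction and to the others because the eigenvalues differ,
      -- hence it is zero. Indexing by a subtype treats the cases `t 0 = t 1` and `t 0 ≠ t 1`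
      -- together.
      let v := ∑ i : {i : Fin 2 // s = t i}, inner ℂ (J (k i)) u • J (k i)
      have hv : v ∈ Submodule.span ℂ (Set.range fun i : {i : Fin 2 // s = t i} => J (k i)) :=
        Submodule.sum_mem _ fun i _ => Submodule.smul_mem _ _ (Submodule.subset_span ⟨i, rfl⟩)
      have hve : v ∈ eigenspace A (s : ℂ) :=
        Submodule.sum_mem _ fun i _ => Submodule.smul_mem _ _
          ((hmem _ _).2 ⟨k i, rfl, (congrArg (fun r => pencil P J W r (k i) = 0) i.2).mpr (hk i)⟩)
      have : u - v = 0 := by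
        refine hzero s _ hs (Submodule.sub_mem _ hu hve) fun j => ?_
        by_cases hj : s = t j
        · have : inner ℂ (J (k j)) v = inner ℂ (J (k j)) u := by
            rw [inner_sum, Finset.sum_eq_single ⟨j, hj⟩]
            · rw [inner_smul_right, inner_self_eq_norm_sq_to_K, ho.1 j]
              simp
            · intro i _ hi
              rw [inner_smul_right, ho.2 (fun h => hi (Subtype.ext h.symm)), mul_zero]
            · simp
          rw [inner_sub_right, this, sub_self]
        · obtain ⟨x, hx, hx'⟩ := (hmem _ _).1 (Submodule.sub_mem _ hu hve)
          rw [← hx]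
          exact inner_eq_zero_of_pencil hP hW (Ne.symm hj) (hk j) hx'
      rw [sub_eq_zero.1 this]
      exact hv
    · rw [Submodule.span_le]
      rintro _ ⟨i, rfl⟩
      exact (hmem _ _).2 ⟨k i, rfl, (congrArg (fun r => pencil P J W r (k i) = 0) i.2).mpr (hk i)⟩
  have hrank : ∀ s : ℝ, s < 0 → Module.rank ℂ (eigenspace A (s : ℂ)) =
      (if s = t 0 then 1 else 0) + (if s = t 1 then 1 else 0) := by
    intro s hs
    have hli : LinearIndependent ℂ (fun i : {i : Fin 2 // s = t i} => J (k i)) :=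
      (ho.linearIndependent).comp _ Subtype.val_injective
    have : FiniteDimensional ℂ (Submodule.span ℂ
        (Set.range fun i : {i : Fin 2 // s = t i} => J (k i))) :=
      FiniteDimensional.span_of_finite ℂ (Set.finite_range _)
    rw [hspan s hs, ← Module.finrank_eq_rank, finrank_span_eq_card hli, Fintype.card_subtype, Finset.card_filter, Fin.sum_univ_two]
    push_cast
    rfl
  -- On a normalized eigenvector the vanishing form gives `-t = ⟨Jk, W Jk⟩ - ‖Pk‖²`.
  have hbound : ∀ i, -t i ≤ E := by
    intro i
    have h1 := re_inner_pencil (J := J) (W := W) hP hPP (t i) (k i)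
    have h2 := hE (k i)
    have h3 : ‖J (k i)‖ = 1 := ho.1 i
    rw [hk i, inner_zero_right, Complex.zero_re, h3] at h1
    rw [h3] at h2
    linarith
  refine ⟨-t 0, -t 1, by linarith [ht 0], by linarith [ht 1], hbound 0, hbound 1, ?_, ?_⟩
  · simp only [neg_neg]
    ext s
    simp only [negSpectrum, Set.mem_ofPred_eq, Set.mem_insert_iff, Set.mem_singleton_iff]
    constructor
    · rintro ⟨hs, hres⟩
      by_contra! hne
      apply hres
      have hi : Function.Injective (pencil P J W s) := by
        rw [injective_iff_map_eq_zero]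
        intro x hx
        by_contra hx0
        refine apply_ne_zero_of_pencil hN hx0 hx (hzero s _ hs ((hmem _ _).2 ⟨x, rfl, hx⟩) ?_)
        intro i
        refine inner_eq_zero_of_pencil hP hW ?_ (hk i) hx
        fin_cases i
        · exact hne.1.symm
        · exact hne.2.symm
      obtain ⟨v, hv⟩ := isUnit_pencil hP hPP hc hs.le hi
      let R : K →L[ℂ] K := ↑v⁻¹
      have hR₁ : ∀ x, R (pencil P J W s x) = x := fun x => by
        rw [← hv, ← mul_apply_eq_comp, Units.inv_mul, one_apply_eq_self]
      have hR₂ : ∀ x, pencil P J W s (R x) = x := fun x => by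
        rw [← hv, ← mul_apply_eq_comp, Units.mul_inv, one_apply_eq_self]
      -- The equation `(A - s) u = w` reads `B(s) k = J* w` with `u = J k`, so the resolvent is `J
      -- B(s)⁻¹ J*`.
      refine ⟨J ∘L R ∘L J.adjoint, fun w => ?_, fun u => ?_⟩
      · have hg : (J (R (J.adjoint w)), w + (s : ℂ) • J (R (J.adjoint w))) ∈ A.graph := by
          rw [hA]
          refine ⟨_, rfl, ?_⟩
          have h1 := hR₂ (J.adjoint w)
          rw [hpen, sub_eq_iff_eq_add] at h1
          rw [h1, map_add, map_smul]
        obtain ⟨y, hy1, hy2⟩ := (LinearPMap.mem_graph_iff A).1 hg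
        simp only at hy1 hy2
        simp only [ContinuousLinearMap.comp_apply]
        have hd : J (R (J.adjoint w)) ∈ A.domain := hy1 ▸ y.2
        refine ⟨hd, ?_⟩
        have : (⟨J (R (J.adjoint w)), hd⟩ : A.domain) = y := Subtype.ext hy1.symm
        rw [this, hy2, add_sub_cancel_right]
      · obtain ⟨x, hx, hx'⟩ := (hA _ _).1 (A.mem_graph u)
        simp only [ContinuousLinearMap.comp_apply]
        have : J.adjoint (A u - (s : ℂ) • (u : X)) = pencil P J W s x := by
          rw [hpen, hx', map_sub, map_smul, hx]
        rw [this, hR₁, hx]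
    · intro hs
      have key : ∀ i, t i < 0 ∧ ¬ IsResolventPoint A ((t i : ℝ) : ℂ) := by
        intro i
        refine ⟨ht i, ?_⟩
        rintro ⟨R, -, hR⟩
        have h1 : J (k i) ∈ eigenspace A ((t i : ℝ) : ℂ) := (hmem _ _).2 ⟨k i, rfl, hk i⟩
        have h2 : (J (k i), ((t i : ℝ) : ℂ) • J (k i)) ∈ A.graph := h1
        obtain ⟨y, hy1, hy2⟩ := (LinearPMap.mem_graph_iff A).1 h2
        simp only at hy1 hy2
        have h3 := hR y
        rw [hy2, hy1, sub_self, map_zero] at h3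
        have := ho.1 i
        simp [← h3] at this
      rcases hs with rfl | rfl
      · exact key 0
      · exact key 1
  · simp only [neg_neg]
    exact hrank

end Pencil

end IntervalOp

noncomputable section

namespace IntervalOp

variable {b : ℝ}

/-! ### Multiplication operators -/

/-- Multiplication by an essentially bounded real function, as a bounded operator. -/
def mulL (m : ℝ → ℝ) (hm : MemLp m ∞ (μ b)) : L2 b →L[ℂ] L2 b :=
  (mulOp m hm).mkContinuous ‖hm.toLp m‖ fun u => Lp.norm_smul_le (hm.toLp m) u

theorem mulL_apply (m : ℝ → ℝ) (hm : MemLp m ∞ (μ b)) (u : L2 b) : mulL m hm u = mulOp m hm u := rfl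

theorem inner_mulOp_left (m : ℝ → ℝ) (hm : MemLp m ∞ (μ b)) (u v : L2 b) :
    inner ℂ (mulOp m hm u) v = inner ℂ u (mulOp m hm v) := by
  rw [L2.inner_def, L2.inner_def]
  apply integral_congr_ae
  filter_upwards [coeFn_mulOp m hm u, coeFn_mulOp m hm v] with x h1 h2
  rw [h1, h2, RCLike.inner_apply, RCLike.inner_apply, map_mul, Complex.conj_ofReal]
  ring

theorem coeFn_powOp (hb : 0 < b) (s : ℝ) (u : L2 b) :
    powOp hb s u =ᵐ[μ b] fun x => ((x ^ s : ℝ) : ℂ) * u x :=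
  coeFn_mulOp _ _ u

theorem powOp_powOp (hb : 0 < b) (s r : ℝ) (u : L2 b) :
    powOp hb s (powOp hb r u) = powOp hb (s + r) u := by
  apply Lp.ext
  filter_upwards [coeFn_powOp hb s (powOp hb r u), coeFn_powOp hb r u, coeFn_powOp hb (s + r) u,
    ae_restrict_mem measurableSet_Ioo] with x h1 h2 h3 hx
  rw [h1, h2, h3, Real.rpow_add (hb.trans hx.1)]
  push_cast
  ring

theorem powOp_zero (hb : 0 < b) (u : L2 b) : powOp hb 0 u = u := by
  apply Lp.ext
  filter_upwards [coeFn_powOp hb 0 u] with x h1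
  rw [h1, Real.rpow_zero]
  simp

/-- Multiplication by `x ^ s`, as a bounded operator. -/
def powL (hb : 0 < b) (s : ℝ) : L2 b →L[ℂ] L2 b := mulL (fun x => x ^ s) (memLp_rpow hb s)

/-- The constant function one. -/
def one (b : ℝ) : L2 b := (memLp_const (1 : ℂ)).toLp

theorem coeFn_one : one b =ᵐ[μ b] fun _ => (1 : ℂ) := MemLp.coeFn_toLp _

/-! ### Integration -/

theorem integrable_coe (f : L2 b) : Integrable f (μ b) := (Lp.memLp f).integrable (by norm_num)

/-- `x ↦ ∫ f(s) ds` over all `s > x` in `(b, b + 1)`. -/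
def tail (f : ℝ → ℂ) (b x : ℝ) : ℂ := ∫ s in Ioi x, f s ∂(μ b)

theorem stronglyMeasurable_tail (f : L2 b) : StronglyMeasurable (tail f b) := by
  have h : tail f b = fun x =>
      ∫ s, {p : ℝ × ℝ | p.1 < p.2}.indicator (fun p => f p.2) (x, s) ∂(μ b) := by
    funext x
    rw [tail, ← integral_indicator measurableSet_Ioi]
    rfl
  rw [h]
  have h2 : StronglyMeasurable ({p : ℝ × ℝ | p.1 < p.2}.indicator fun p => f p.2) :=
    ((Lp.stronglyMeasurable f).comp_measurable measurable_snd).indicator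
      (measurableSet_lt measurable_fst measurable_snd)
  exact h2.integral_prod_right'

theorem norm_sq_eq_integral (f : L2 b) : ‖f‖ ^ 2 = ∫ x, ‖f x‖ ^ 2 ∂(μ b) := by
  have h : ((‖f‖ ^ 2 : ℝ) : ℂ) = ((∫ x, ‖f x‖ ^ 2 ∂(μ b) : ℝ) : ℂ) := by
    have := inner_self_eq_norm_sq_to_K (𝕜 := ℂ) f
    rw [← integral_complex_ofReal]
    push_cast
    refine this.symm.trans ?_
    rw [L2.inner_def]
    refine integral_congr_ae (Filter.Eventually.of_forall fun x => ?_)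
    simp only [inner_self_eq_norm_sq_to_K]
    norm_cast
  exact_mod_cast h

theorem integrable_norm_sq (f : L2 b) : Integrable (fun x => ‖f x‖ ^ 2) (μ b) :=
  (Lp.memLp f).integrable_norm_pow (by norm_num)

/-- The interval has length one, so this is nonnegativity of the variance of `‖f‖`. -/
theorem integral_norm_le (f : L2 b) : ∫ x, ‖f x‖ ∂(μ b) ≤ ‖f‖ := by
  have hp : (μ b) univ = 1 := by simp
  have : IsProbabilityMeasure (μ b) := ⟨hp⟩
  have h1 : (∫ x, ‖f x‖ ∂(μ b)) ^ 2 ≤ ‖f‖ ^ 2 := by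
    set A := ∫ x, ‖f x‖ ∂(μ b)
    have h2 : 0 ≤ ∫ x, (‖f x‖ - A) ^ 2 ∂(μ b) := integral_nonneg fun x => sq_nonneg _
    have h3 : ∫ x, (‖f x‖ - A) ^ 2 ∂(μ b) = ‖f‖ ^ 2 - 2 * A * A + A ^ 2 := by
      have e : ∀ x, (‖f x‖ - A) ^ 2 = ‖f x‖ ^ 2 - 2 * A * ‖f x‖ + A ^ 2 := fun x => by ring
      simp only [e]
      rw [integral_add, integral_sub, integral_const_mul, ← norm_sq_eq_integral]
      · simp [A]
      · exact integrable_norm_sq f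
      · exact (integrable_coe f).norm.const_mul _
      · exact (integrable_norm_sq f).sub ((integrable_coe f).norm.const_mul _)
      · exact integrable_const _
    nlinarith
  exact abs_le_of_sq_le_sq' h1 (norm_nonneg f) |>.2

theorem norm_tail_le (f : L2 b) (x : ℝ) : ‖tail f b x‖ ≤ ‖f‖ :=
  (norm_integral_le_integral_norm _).trans <|
    (setIntegral_le_integral (integrable_coe f).norm
      (Filter.Eventually.of_forall fun _ => norm_nonneg _)).trans (integral_norm_le f)

theorem memLp_tail (f : L2 b) : MemLp (tail f b) 2 (μ b) :=
  MemLp.of_bound (stronglyMeasurable_tail f).aestronglyMeasurable ‖f‖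
    (Filter.Eventually.of_forall (norm_tail_le f))

theorem tail_congr {f g : ℝ → ℂ} (h : f =ᵐ[μ b] g) (x : ℝ) : tail f b x = tail g b x :=
  integral_congr_ae (ae_restrict_of_ae h)

theorem norm_le_of_ae_le {f : L2 b} {C : ℝ} (hC : 0 ≤ C) (h : ∀ᵐ x ∂(μ b), ‖f x‖ ≤ C) :
    ‖f‖ ≤ C := by
  have h : ‖f‖ ≤ (μ b).real univ ^ ((2 : ℝ≥0∞).toReal)⁻¹ * C :=
    Lp.norm_le_of_ae_bound hC h
  have e : (μ b).real univ = 1 := by simp [Measure.real]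
  rwa [e, Real.one_rpow, one_mul] at h

/-- The operator `f ↦ ∫_x^{b+1} f(s) ds` on `L²(b, b + 1)`. -/
def tailL (b : ℝ) : L2 b →L[ℂ] L2 b :=
  LinearMap.mkContinuous
    { toFun := fun f => (memLp_tail f).toLp
      map_add' := fun f g => by
        rw [← MemLp.toLp_add]
        apply MemLp.toLp_congr
        refine Filter.Eventually.of_forall fun x => ?_
        rw [tail_congr (Lp.coeFn_add f g)]
        exact integral_add (integrable_coe f).restrict (integrable_coe g).restrict
      map_smul' := fun c f => by
        rw [RingHom.id_apply, ← MemLp.toLp_const_smul]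
        apply MemLp.toLp_congr
        refine Filter.Eventually.of_forall fun x => ?_
        rw [tail_congr (Lp.coeFn_smul c f)]
        exact integral_smul c _ }
    1 fun f => by
      rw [one_mul]
      refine norm_le_of_ae_le (norm_nonneg f) ?_
      filter_upwards [(memLp_tail f).coeFn_toLp] with x hx
      exact hx ▸ norm_tail_le f x

theorem coeFn_tailL (f : L2 b) : tailL b f =ᵐ[μ b] tail f b := (memLp_tail f).coeFn_toLp

theorem IsTest.setIntegral_deriv {φ : ℝ → ℝ} (h : IsTest b φ) {s : ℝ} (hs : s ∈ Ioo b (b + 1)) :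
    ∫ x in Iio s, ((_root_.deriv φ x : ℝ) : ℂ) ∂(μ b) = φ s := by
  have hφb : φ b = 0 := image_eq_zero_of_notMem_tsupport fun hx => (h.supp hx).1.false
  have h1 : (volume.restrict (Ioo b (b + 1))).restrict (Iio s) = volume.restrict (Ioo b s) := by
    rw [Measure.restrict_restrict measurableSet_Iio]
    congr 1
    ext x
    simp only [mem_inter_iff, mem_Iio, mem_Ioo]
    constructor
    · rintro ⟨h1, h2, -⟩; exact ⟨h2, h1⟩
    · rintro ⟨h1, h2⟩; exact ⟨h2, h1, h2.trans hs.2⟩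
  rw [μ, h1, integral_complex_ofReal, ← integral_Ioc_eq_integral_Ioo,
    ← intervalIntegral.integral_of_le hs.1.le, intervalIntegral.integral_eq_sub_of_hasDerivAt
      (f := φ) (fun x _ => (h.smooth.differentiable (by simp) x).hasDerivAt)
      (h.deriv.smooth.continuous.intervalIntegrable _ _), hφb, sub_zero]

/-- `(∫_x^{b+1} f(s) ds)' = -f`. -/
theorem hasWeakDeriv_tailL (f : L2 b) : HasWeakDeriv (tailL b f) (-f) := by
  intro φ hφ
  have e1 : ∫ x in Ioo b (b + 1), ((deriv φ x : ℝ) : ℂ) * tailL b f x =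
      ∫ x, (∫ s, {p : ℝ × ℝ | p.1 < p.2}.indicator
        (fun p => ((deriv φ p.1 : ℝ) : ℂ) * f p.2) (x, s) ∂(μ b)) ∂(μ b) := by
    apply integral_congr_ae
    filter_upwards [coeFn_tailL f] with x hx
    rw [hx, tail, ← integral_const_mul, ← integral_indicator measurableSet_Ioi]
    rfl
  have hint : Integrable (fun p : ℝ × ℝ => ((deriv φ p.1 : ℝ) : ℂ) * f p.2) ((μ b).prod (μ b)) :=
    ((hφ.deriv.memLp 2).integrable (by norm_num)).mul_prod (integrable_coe f)
  have hm : MeasurableSet {p : ℝ × ℝ | p.1 < p.2} := measurableSet_lt measurable_fst measurable_snd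
  -- Fubini on the triangle `x < s`: the inner integral of `φ'` over `(b, s)` is then `φ s`.
  rw [e1, integral_integral_swap (f := fun x s => {p : ℝ × ℝ | p.1 < p.2}.indicator
        (fun p => ((deriv φ p.1 : ℝ) : ℂ) * f p.2) (x, s)) (hint.indicator hm), ← integral_neg]
  apply integral_congr_ae
  filter_upwards [Lp.coeFn_neg f, ae_restrict_mem measurableSet_Ioo] with s hs hsI
  rw [hs, Pi.neg_apply, mul_neg, neg_neg, ← hφ.setIntegral_deriv hsI, ← integral_mul_const,
    ← integral_indicator measurableSet_Iio]
  rfl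

/-! ### Functions with vanishing weak derivative -/

/-- The primitive starting at `b` vanishes to the left of the support, and to its right it equals
the total integral, which is zero. -/
theorem IsTest.exists_primitive {η : ℝ → ℝ} (h : IsTest b η) (h0 : ∫ x, η x = 0) :
    ∃ φ, IsTest b φ ∧ _root_.deriv φ = η := by
  -- The midpoint is inserted so that a least and a greatest element exist even when `η = 0`.
  have hK : IsCompact (insert (b + 1 / 2) (tsupport η)) := h.compact.isCompact.insert _
  have hsub : insert (b + 1 / 2) (tsupport η) ⊆ Ioo b (b + 1) :=
    insert_subset ⟨by linarith, by linarith⟩ h.supp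
  obtain ⟨l, hl, hl'⟩ := hK.exists_isLeast (insert_nonempty _ _)
  obtain ⟨r, hr, hr'⟩ := hK.exists_isGreatest (insert_nonempty _ _)
  have hη : ∀ x, x ∉ Icc l r → η x = 0 := fun x hx =>
    image_eq_zero_of_notMem_tsupport fun hx' =>
      hx ⟨hl' (mem_insert_of_mem _ hx'), hr' (mem_insert_of_mem _ hx')⟩
  have hc : Continuous η := h.smooth.continuous
  let φ : ℝ → ℝ := fun x => ∫ t in b..x, η t
  have hd : ∀ x, HasDerivAt φ (η x) x := fun x =>
    intervalIntegral.integral_hasDerivAt_right (hc.intervalIntegrable _ _)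
      (hc.stronglyMeasurableAtFilter _ _) hc.continuousAt
  have hdφ : _root_.deriv φ = η := funext fun x => (hd x).deriv
  have hout : ∀ x, x ∉ Icc l r → φ x = 0 := by
    intro x hx
    rw [mem_Icc, not_and_or, not_le, not_le] at hx
    rcases hx with hx | hx
    · have : ∫ t in b..x, η t = ∫ t in b..x, (0 : ℝ) := by
        refine intervalIntegral.integral_congr fun t ht => hη t fun ht' => ?_
        exact absurd (ht.2.trans_lt (max_lt (hsub hl).1 hx)) (not_lt.2 ht'.1)
      simpa using this
    · refine (intervalIntegral.integral_eq_integral_of_support_subset ?_).trans h0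
      intro t ht
      have : t ∈ Icc l r := by
        by_contra h'
        exact ht (hη t h')
      exact ⟨(hsub hl).1.trans_le this.1, this.2.trans hx.le⟩
  have hsupp : tsupport φ ⊆ Icc l r := by
    refine closure_minimal (fun x hx => ?_) isClosed_Icc
    by_contra h'
    exact hx (hout x h')
  refine ⟨φ, ⟨?_, ?_, ?_⟩, hdφ⟩
  · exact contDiff_infty_iff_deriv.2 ⟨fun x => (hd x).differentiableAt, hdφ ▸ h.smooth⟩
  · exact HasCompactSupport.intro isCompact_Icc hout
  · exact hsupp.trans (Icc_subset_Ioo (hsub hl).1 (hsub hr).2)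

theorem exists_isTest_integral_eq_one (b : ℝ) : ∃ χ, IsTest b χ ∧ ∫ x, χ x = 1 := by
  let B : ContDiffBump (b + 1 / 2) := ⟨1 / 8, 1 / 4, by norm_num, by norm_num⟩
  refine ⟨B.normed volume, ⟨B.contDiff_normed, B.hasCompactSupport_normed, ?_⟩, B.integral_normed⟩
  rw [B.tsupport_normed_eq, Real.closedBall_eq_Icc]
  refine Icc_subset_Ioo ?_ ?_ <;> simp only [B] <;> linarith

theorem IsTest.setIntegral {φ : ℝ → ℝ} (h : IsTest b φ) :
    ∫ x in Ioo b (b + 1), ((φ x : ℝ) : ℂ) = ((∫ x, φ x : ℝ) : ℂ) := by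
  rw [integral_complex_ofReal, setIntegral_eq_integral_of_forall_compl_eq_zero]
  intro x hx
  exact image_eq_zero_of_notMem_tsupport fun hx' => hx (h.supp hx')

theorem IsTest.sub_const_mul {φ ψ : ℝ → ℝ} (h : IsTest b φ) (h' : IsTest b ψ) (c : ℝ) :
    IsTest b (fun x => φ x - c * ψ x) where
  smooth := h.smooth.sub (contDiff_const.mul h'.smooth)
  compact := h.compact.sub (h'.compact.mul_left (f := fun _ => c))
  supp := (tsupport_sub φ (fun x => c * ψ x)).trans
    (union_subset h.supp ((tsupport_mul_subset_right (f := fun _ => c)).trans h'.supp))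

/-- The du Bois-Reymond argument: with `χ` of integral one and `m = ∫ ψ`, the function `ψ - m χ` has
mean zero, so it is the derivative of a test function and `f` annihilates it. The constant is `∫ χ
f`. -/
theorem eq_const_of_hasWeakDeriv_zero {f : L2 b} (h : HasWeakDeriv f 0) :
    ∃ c : ℂ, f = c • one b := by
  obtain ⟨χ, hχ, hχ1⟩ := exists_isTest_integral_eq_one b
  refine ⟨∫ x in Ioo b (b + 1), ((χ x : ℝ) : ℂ) * f x, ?_⟩
  set c := ∫ x in Ioo b (b + 1), ((χ x : ℝ) : ℂ) * f x with hc
  refine sub_eq_zero.1 (eq_zero_of_test _ fun ψ hψ => ?_)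
  set m := ∫ x, ψ x with hm
  have hη := hψ.sub_const_mul hχ m
  have hint : ∀ {φ : ℝ → ℝ}, IsTest b φ → Integrable φ := fun hφ =>
    hφ.smooth.continuous.integrable_of_hasCompactSupport hφ.compact
  obtain ⟨φ, hφ, hdφ⟩ := hη.exists_primitive (by
    rw [integral_sub (hint hψ) ((hint hχ).const_mul m), integral_const_mul, hχ1, mul_one, ← hm,
      sub_self])
  have h1 := h φ hφ
  have h2 : ∫ x in Ioo b (b + 1), ((φ x : ℝ) : ℂ) * (0 : L2 b) x = 0 := by
    apply integral_eq_zero_of_ae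
    filter_upwards [Lp.coeFn_zero ℂ 2 (μ b)] with x hx
    rw [hx]
    simp
  rw [h2, neg_zero, hdφ] at h1
  have h3 : ∫ x in Ioo b (b + 1), ((ψ x - m * χ x : ℝ) : ℂ) * f x =
      (∫ x in Ioo b (b + 1), ((ψ x : ℝ) : ℂ) * f x) - m * c := by
    rw [hc, ← integral_const_mul, ← integral_sub (hψ.integrable_mul f)
      ((hχ.integrable_mul f).const_mul _)]
    refine integral_congr_ae (Filter.Eventually.of_forall fun x => ?_)
    push_cast
    ring
  have h4 : ∫ x in Ioo b (b + 1), ((ψ x : ℝ) : ℂ) * (f - c • one b : L2 b) x =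
      (∫ x in Ioo b (b + 1), ((ψ x : ℝ) : ℂ) * f x) -
        c * ∫ x in Ioo b (b + 1), ((ψ x : ℝ) : ℂ) := by
    rw [← integral_const_mul, ← integral_sub (hψ.integrable_mul f)
      (((hψ.memLp 1).integrable le_rfl).const_mul _)]
    apply integral_congr_ae
    filter_upwards [Lp.coeFn_sub f (c • one b), Lp.coeFn_smul c (one b), coeFn_one (b := b)]
      with x h1 h2 h3
    rw [h1, Pi.sub_apply, h2, Pi.smul_apply, h3, smul_eq_mul]
    ring
  rw [h4, hψ.setIntegral, ← hm, mul_comm c]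
  rw [h3] at h1
  exact h1

theorem hasWeakDeriv_one : HasWeakDeriv (one b) 0 := by
  intro φ hφ
  have h1 : ∫ x in Ioo b (b + 1), ((deriv φ x : ℝ) : ℂ) * one b x =
      ∫ x in Ioo b (b + 1), ((deriv φ x : ℝ) : ℂ) := by
    apply integral_congr_ae
    filter_upwards [coeFn_one (b := b)] with x hx
    rw [hx, mul_one]
  have h2 : ∫ x in Ioo b (b + 1), ((φ x : ℝ) : ℂ) * (0 : L2 b) x = 0 := by
    apply integral_eq_zero_of_ae
    filter_upwards [Lp.coeFn_zero ℂ 2 (μ b)] with x hx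
    rw [hx]
    simp
  rw [h1, h2, hφ.deriv.setIntegral, neg_zero,
    integral_eq_zero_of_hasDerivAt_of_integrable
      (fun x => (hφ.smooth.differentiable (by simp) x).hasDerivAt)
      (hφ.deriv.smooth.continuous.integrable_of_hasCompactSupport hφ.deriv.compact)
      (hφ.smooth.continuous.integrable_of_hasCompactSupport hφ.compact), Complex.ofReal_zero]

/-! ### Parametrization of `H²(b, b + 1)` -/

theorem HasWeakDeriv.unique {f g g' : L2 b} (h : HasWeakDeriv f g) (h' : HasWeakDeriv f g') :
    g = g' :=
  (weakD b).mem_graph_snd_inj (mem_graph_weakD.2 h) (mem_graph_weakD.2 h') rfl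

theorem hasWeakDeriv_firstOp (hb : 0 < b) (β : ℝ) (u : H2 b) :
    HasWeakDeriv (powOp hb (-β) u) (firstOp hb β u) :=
  mem_graph_weakD.1 (LinearPMap.mem_graph (weakD b) ⟨powOp hb (-β) u, powOp_mem_domain hb (-β) u⟩)

theorem hasWeakDeriv_secondOp (hb : 0 < b) (α β : ℝ) (u : H2 b) :
    HasWeakDeriv (powOp hb (-α) (firstOp hb β u)) (secondOp hb α β u) :=
  mem_graph_weakD.1 (LinearPMap.mem_graph (weakD b)
    ⟨powOp hb (-α) (firstOp hb β u), firstOp_mem_domain hb α β u⟩)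

theorem secondOp_eq (hb : 0 < b) {α β : ℝ} {u : H2 b} {f g : L2 b}
    (h : HasWeakDeriv (powOp hb (-β) u) f) (h' : HasWeakDeriv (powOp hb (-α) f) g) :
    secondOp hb α β u = g := by
  have h1 := (hasWeakDeriv_firstOp hb β u).unique h
  have h2 := hasWeakDeriv_secondOp hb α β u
  rw [h1] at h2
  exact h2.unique h'

/-- Multiplying `x^(-α) f` by `x^α` shows that `f` itself has a weak derivative; the product rule
then applies twice to `x^β w`. -/
theorem powOp_mem_H2 (hb : 0 < b) (α β : ℝ) {w f g : L2 b} (h : HasWeakDeriv w f)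
    (h' : HasWeakDeriv (powOp hb (-α) f) g) : powOp hb β w ∈ H2 b := by
  have h1 := h'.rpowMul hb α
  rw [powOp_powOp, add_neg_cancel, powOp_zero] at h1
  exact ⟨_, _, h.rpowMul hb β, (h1.rpowMul hb β).add ((h.rpowMul hb (β - 1)).smul _)⟩

theorem hasWeakDeriv_powOp_one (hb : 0 < b) (s : ℝ) :
    HasWeakDeriv (powOp hb s (one b)) ((s : ℂ) • powOp hb (s - 1) (one b)) := by
  simpa using (hasWeakDeriv_one (b := b)).rpowMul hb s

/-- The parameters of an element of `H²(b, b + 1)`. -/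
abbrev Param (b : ℝ) : Type := WithLp 2 (EuclideanSpace ℂ (Fin 2) × L2 b)

/-- The solution operator `g ↦ u` of `(x ^ (-α) (x ^ (-β) u)')' = x ^ (-(α + β)) g` with
`u(b + 1) = u'(b + 1) = 0`. -/
def solL (hb : 0 < b) (α β : ℝ) : L2 b →L[ℂ] L2 b :=
  powL hb β ∘L tailL b ∘L powL hb α ∘L tailL b ∘L powL hb (-(α + β))

theorem solL_apply (hb : 0 < b) (α β : ℝ) (g : L2 b) :
    solL hb α β g = powOp hb β (tailL b (powOp hb α (tailL b (powOp hb (-(α + β)) g)))) := rfl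

/-- `(c, g) ↦ c₀ x ^ β + c₁ x ^ (α + β + 1) + solL g`, a bijection onto `H²(b, b + 1)`. -/
def paramL (hb : 0 < b) (α β : ℝ) : Param b →L[ℂ] L2 b :=
  ((EuclideanSpace.proj (0 : Fin 2) : EuclideanSpace ℂ (Fin 2) →L[ℂ] ℂ) ∘L
      WithLp.fstL 2 ℂ (EuclideanSpace ℂ (Fin 2)) (L2 b)).smulRight (powOp hb β (one b)) +
    ((EuclideanSpace.proj (1 : Fin 2) : EuclideanSpace ℂ (Fin 2) →L[ℂ] ℂ) ∘L
      WithLp.fstL 2 ℂ (EuclideanSpace ℂ (Fin 2)) (L2 b)).smulRight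
        (powOp hb (α + β + 1) (one b)) +
    solL hb α β ∘L WithLp.sndL 2 ℂ (EuclideanSpace ℂ (Fin 2)) (L2 b)

theorem paramL_apply (hb : 0 < b) (α β : ℝ) (k : Param b) :
    paramL hb α β k = k.fst 0 • powOp hb β (one b) + k.fst 1 • powOp hb (α + β + 1) (one b) +
      solL hb α β k.snd := rfl

/-- The projection `(c, g) ↦ (0, g)`. -/
def sndProj (b : ℝ) : Param b →L[ℂ] Param b :=
  (WithLp.prodContinuousLinearEquiv 2 ℂ (EuclideanSpace ℂ (Fin 2)) (L2 b)).symm.toContinuousLinearMap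
    ∘L ContinuousLinearMap.inr ℂ (EuclideanSpace ℂ (Fin 2)) (L2 b)
    ∘L WithLp.sndL 2 ℂ (EuclideanSpace ℂ (Fin 2)) (L2 b)

theorem sndProj_apply (k : Param b) : sndProj b k = WithLp.toLp 2 (0, k.snd) := rfl

theorem sndProj_sndProj (k : Param b) : sndProj b (sndProj b k) = sndProj b k := rfl

theorem inner_sndProj (k k' : Param b) :
    inner ℂ k' (sndProj b k) = inner ℂ k'.snd k.snd := by
  rw [WithLp.prod_inner_apply, sndProj_apply]
  simp

theorem sndProj_isSymmetric :
    ((sndProj b : Param b →L[ℂ] Param b) : Param b →ₗ[ℂ] Param b).IsSymmetric := by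
  intro x y
  simp only [ContinuousLinearMap.coe_coe]
  rw [← inner_conj_symm, inner_sndProj, inner_sndProj, inner_conj_symm]

theorem norm_sndProj (k : Param b) : ‖sndProj b k‖ = ‖k.snd‖ := by
  rw [sndProj_apply]
  exact WithLp.norm_toLp_snd 2 _ _ _

theorem sndProj_eq_zero {k : Param b} : sndProj b k = 0 ↔ k.snd = 0 := by
  rw [← norm_eq_zero, norm_sndProj, norm_eq_zero]

theorem fst_eq_zero_of_sndProj_eq {k : Param b} (h : sndProj b k = k) : k.fst = 0 := by
  rw [← h]
  rfl

/-- The kernel of `sndProj` is `ℂ²`. -/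
def kerSndProj (b : ℝ) : LinearMap.ker (sndProj b : Param b →ₗ[ℂ] Param b) ≃ₗ[ℂ]
    EuclideanSpace ℂ (Fin 2) where
  toFun k := (k : Param b).fst
  map_add' _ _ := rfl
  map_smul' _ _ := rfl
  invFun c := ⟨WithLp.toLp 2 (c, 0), sndProj_eq_zero.2 rfl⟩
  left_inv k := by
    have : (k : Param b).snd = 0 := sndProj_eq_zero.1 k.2
    apply Subtype.ext
    change WithLp.toLp 2 ((k : Param b).fst, (0 : L2 b)) = k
    rw [← this]
    rfl
  right_inv _ := rfl

instance : FiniteDimensional ℂ (LinearMap.ker (sndProj b : Param b →ₗ[ℂ] Param b)) :=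
  (kerSndProj b).symm.finiteDimensional

theorem finrank_ker_sndProj :
    Module.finrank ℂ (LinearMap.ker (sndProj b : Param b →ₗ[ℂ] Param b)) = 2 := by
  rw [(kerSndProj b).finrank_eq]
  simp

/-- `x ^ (-β) u` for `u = paramL (c, g)`. -/
theorem paramL_eq_powOp (hb : 0 < b) (α β : ℝ) (k : Param b) :
    paramL hb α β k = powOp hb β (k.fst 0 • one b + k.fst 1 • powOp hb (α + 1) (one b) +
      tailL b (powOp hb α (tailL b (powOp hb (-(α + β)) k.snd)))) := by
  rw [paramL_apply, solL_apply, map_add, map_add, map_smul, map_smul, powOp_powOp,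
    show β + (α + 1) = α + β + 1 by ring]

theorem hasWeakDeriv_param (hb : 0 < b) {α : ℝ} (c₀ c₁ : ℂ) (G : L2 b) :
    HasWeakDeriv (c₀ • one b + c₁ • powOp hb (α + 1) (one b) + tailL b (powOp hb α (tailL b G)))
        (powOp hb α ((c₁ * ((α + 1 : ℝ) : ℂ)) • one b - tailL b G)) ∧
      HasWeakDeriv (powOp hb (-α) (powOp hb α ((c₁ * ((α + 1 : ℝ) : ℂ)) • one b - tailL b G)))
        G := by
  constructor
  · have h := (((hasWeakDeriv_one (b := b)).smul c₀).add
      ((hasWeakDeriv_powOp_one hb (α + 1)).smul c₁)).add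
      (hasWeakDeriv_tailL (powOp hb α (tailL b G)))
    convert h using 1
    rw [map_sub, map_smul, add_sub_cancel_right, smul_zero, zero_add, smul_smul, sub_eq_add_neg]
  · rw [powOp_powOp, neg_add_cancel, powOp_zero]
    have h := ((hasWeakDeriv_one (b := b)).smul (c₁ * ((α + 1 : ℝ) : ℂ))).add
      ((hasWeakDeriv_tailL G).smul (-1))
    convert h using 1
    · rw [neg_one_smul, sub_eq_add_neg]
    · simp

theorem paramL_mem_H2 (hb : 0 < b) (α β : ℝ) (k : Param b) : paramL hb α β k ∈ H2 b := by
  obtain ⟨h1, h2⟩ := hasWeakDeriv_param hb (α := α) (k.fst 0) (k.fst 1)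
    (powOp hb (-(α + β)) k.snd)
  rw [paramL_eq_powOp]
  exact powOp_mem_H2 hb α β h1 h2

theorem secondOp_paramL (hb : 0 < b) (α β : ℝ) (k : Param b) :
    secondOp hb α β ⟨paramL hb α β k, paramL_mem_H2 hb α β k⟩ = powOp hb (-(α + β)) k.snd := by
  obtain ⟨h1, h2⟩ := hasWeakDeriv_param hb (α := α) (k.fst 0) (k.fst 1)
    (powOp hb (-(α + β)) k.snd)
  refine secondOp_eq hb ?_ h2
  change HasWeakDeriv (powOp hb (-β) (paramL hb α β k)) _
  rwa [paramL_eq_powOp, powOp_powOp, neg_add_cancel, powOp_zero]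

/-- Undo the two derivatives in turn; each leaves a constant. The inner one becomes the coefficient
of `x^(α+1)` after division by `α + 1 ≠ 0`. Injectivity of the parametrization plays no role in the
argument. -/
theorem exists_paramL_eq (hb : 0 < b) {α β : ℝ} (hα : 0 ≤ α) (u : H2 b) :
    ∃ k, paramL hb α β k = u := by
  have h1 := hasWeakDeriv_firstOp hb β u
  have h2 := hasWeakDeriv_secondOp hb α β u
  set f := firstOp hb β u
  set G := secondOp hb α β u
  have hα' : ((α + 1 : ℝ) : ℂ) ≠ 0 := by
    norm_cast
    positivity
  obtain ⟨c, hc⟩ := eq_const_of_hasWeakDeriv_zero (by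
    simpa using h2.add (hasWeakDeriv_tailL G) :
      HasWeakDeriv (powOp hb (-α) f + tailL b G) 0)
  have hf : f = powOp hb α (c • one b - tailL b G) := by
    rw [← hc, add_sub_cancel_right, powOp_powOp, add_neg_cancel, powOp_zero]
  obtain ⟨h3, -⟩ := hasWeakDeriv_param hb (α := α) 0 (c / ((α + 1 : ℝ) : ℂ)) G
  rw [div_mul_cancel₀ _ hα', ← hf] at h3
  obtain ⟨d, hd⟩ := eq_const_of_hasWeakDeriv_zero (by
    simpa using h1.add (h3.smul (-1)) : HasWeakDeriv (powOp hb (-β) (u : L2 b) +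
      (-1 : ℂ) • ((0 : ℂ) • one b + (c / ((α + 1 : ℝ) : ℂ)) • powOp hb (α + 1) (one b) +
        tailL b (powOp hb α (tailL b G)))) 0)
  refine ⟨WithLp.toLp 2 (!₂[d, c / ((α + 1 : ℝ) : ℂ)], powOp hb (α + β) G), ?_⟩
  rw [paramL_eq_powOp]
  simp only [WithLp.toLp_fst, WithLp.toLp_snd, powOp_powOp, neg_add_cancel, powOp_zero]
  have h4 : powOp hb (-β) (u : L2 b) = d • one b +
      (c / ((α + 1 : ℝ) : ℂ)) • powOp hb (α + 1) (one b) +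
        tailL b (powOp hb α (tailL b G)) := by
    rw [← hd]
    simp only [zero_smul, zero_add, neg_smul, one_smul]
    abel
  simp only [Matrix.cons_val_zero, Matrix.cons_val_one]
  rw [← h4, powOp_powOp, add_neg_cancel, powOp_zero]

/-- The factor `x^(-(α+β))` built into `solL` occurs twice and cancels the weight `x^(2(α+β))`. -/
theorem form_paramL (hb : 0 < b) (α β : ℝ) (k k' : Param b) :
    form hb α β ⟨paramL hb α β k', paramL_mem_H2 hb α β k'⟩
      ⟨paramL hb α β k, paramL_mem_H2 hb α β k⟩ = inner ℂ k' (sndProj b k) := by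
  rw [form_eq_inner, secondOp_paramL, secondOp_paramL, inner_sndProj, powOp_powOp]
  have : inner ℂ (powOp hb (-(α + β)) k'.snd) (powOp hb (2 * (α + β) + -(α + β)) k.snd) =
      inner ℂ k'.snd (powOp hb (-(α + β)) (powOp hb (2 * (α + β) + -(α + β)) k.snd)) :=
    inner_mulOp_left _ _ _ _
  rw [this, powOp_powOp, show -(α + β) + (2 * (α + β) + -(α + β)) = 0 by ring, powOp_zero]

theorem mem_graph_HbSub (hb : 0 < b) (α β : ℝ) (V : ℝ → ℝ) (hV : MemLp V ∞ (μ b)) (u w : L2 b) :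
    (u, w) ∈ (HbSub hb α β V hV).graph ↔ (u, w + mulOp V hV u) ∈ (Hb hb α β).graph := by
  simp only [LinearPMap.mem_graph_iff, HbSub]
  constructor
  · rintro ⟨y, hy1, hy2⟩
    have hy : (y : L2 b) ∈ (Hb hb α β).domain := y.2.1
    refine ⟨⟨y, hy⟩, hy1, ?_⟩
    rw [← hy2, ← hy1]
    exact (sub_add_cancel _ _).symm
  · rintro ⟨y, hy1, hy2⟩
    refine ⟨⟨y, y.2, trivial⟩, hy1, ?_⟩
    rw [← sub_eq_iff_eq_add, ← hy1] at hy2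
    exact hy2

/-- Every test vector `v` in `H²` is some `J k'`, so the weak equation can be tested on `K`, where
it says that two vectors have equal inner products with every `k'`. -/
theorem mem_graph_HbSub_iff (hb : 0 < b) {α β : ℝ} (hα : 0 ≤ α) (V : ℝ → ℝ)
    (hV : MemLp V ∞ (μ b)) (u w : L2 b) :
    (u, w) ∈ (HbSub hb α β V hV).graph ↔ ∃ k, paramL hb α β k = u ∧
      pencil (sndProj b) (paramL hb α β) (mulL V hV) 0 k = (paramL hb α β).adjoint w := by
  rw [mem_graph_HbSub, mem_graph_Hb]
  have key : ∀ k k' : Param b,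
      (inner ℂ k' (pencil (sndProj b) (paramL hb α β) (mulL V hV) 0 k) =
        inner ℂ k' ((paramL hb α β).adjoint w)) ↔
      form hb α β ⟨paramL hb α β k', paramL_mem_H2 hb α β k'⟩
        ⟨paramL hb α β k, paramL_mem_H2 hb α β k⟩ =
        inner ℂ (paramL hb α β k') (w + mulOp V hV (paramL hb α β k)) := by
    intro k k'
    rw [inner_pencil_right, form_paramL, ContinuousLinearMap.adjoint_inner_right, mulL_apply,
      inner_add_right, Complex.ofReal_zero, zero_mul, sub_zero, sub_eq_iff_eq_add]
  constructor
  · rintro ⟨hu, h⟩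
    obtain ⟨k, hk⟩ := exists_paramL_eq hb hα (β := β) ⟨u, hu⟩
    refine ⟨k, hk, ext_inner_left ℂ fun k' => (key k k').2 ?_⟩
    have := h ⟨paramL hb α β k', paramL_mem_H2 hb α β k'⟩
    subst hk
    exact this
  · rintro ⟨k, rfl, hk⟩
    refine ⟨paramL_mem_H2 hb α β k, fun v => ?_⟩
    obtain ⟨k', hk'⟩ := exists_paramL_eq hb hα (β := β) v
    have h := (key k k').1 (by rw [hk])
    have e : v = ⟨paramL hb α β k', paramL_mem_H2 hb α β k'⟩ := Subtype.ext hk'.symm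
    rw [e]
    exact h

/-! ### The estimate for the solution operator -/

theorem memLp_of_continuousOn_Icc {l r : ℝ} {f : ℝ → ℝ} (hf : ContinuousOn f (Icc l r))
    (p : ℝ≥0∞) : MemLp f p (volume.restrict (Ioo l r)) := by
  obtain ⟨C, hC⟩ := isCompact_Icc.exists_bound_of_continuousOn hf
  refine MemLp.of_bound
    ((hf.mono Ioo_subset_Icc_self).aestronglyMeasurable measurableSet_Ioo) C ?_
  filter_upwards [ae_restrict_mem measurableSet_Ioo] with x hx
  exact hC x (Ioo_subset_Icc_self hx)

theorem integral_mul_le_sqrt {m : Measure ℝ} {f g : ℝ → ℝ} (hf : MemLp f 2 m) (hg : MemLp g 2 m)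
    (hf0 : 0 ≤ᵐ[m] f) (hg0 : 0 ≤ᵐ[m] g) :
    ∫ x, f x * g x ∂m ≤ √(∫ x, f x ^ 2 ∂m) * √(∫ x, g x ^ 2 ∂m) := by
  have h := integral_mul_le_Lp_mul_Lq_of_nonneg Real.HolderConjugate.two_two hf0 hg0
    (by simpa using hf) (by simpa using hg)
  simpa [Real.sqrt_eq_rpow] using h

theorem restrict_Ioi {t : ℝ} (ht : b ≤ t) :
    (μ b).restrict (Ioi t) = volume.restrict (Ioo t (b + 1)) := by
  rw [μ, Measure.restrict_restrict measurableSet_Ioi]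
  congr 1
  ext x
  simp only [mem_inter_iff, mem_Ioi, mem_Ioo]
  constructor
  · rintro ⟨h1, -, h3⟩; exact ⟨h1, h3⟩
  · rintro ⟨h1, h2⟩; exact ⟨h1, ht.trans_lt h1, h2⟩

/-- Raising `x` and `t` to `s` leaves `s^(-ν/2)`, and `s > s - x` removes the dependence on `b`. As
`s - x < 1`, the exponent may be lowered to `-(1/2 + σ)` with `σ = (ν+1)/4`. Here `σ > 0` makes the
Cauchy-Schwarz integral in `s` a pure power `(t-x)^(-2σ)`, and `σ < 1`, that is `ν < 3`, makes its
root integrable in `t` at `x`. -/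
theorem weight_le {α β ν x t s : ℝ} (hα : 0 ≤ α) (hν : 0 ≤ ν) (hν3 : ν < 3) (hνβ : ν ≤ 2 * β)
    (hx : 0 < x) (hxt : x < t) (hts : t < s) (hs : s < x + 1) :
    x ^ (β - ν / 2) * t ^ α * s ^ (-(α + β)) ≤ (s - x) ^ (-(1 / 2 + (ν + 1) / 4)) := by
  have hs0 : 0 < s := by linarith
  calc x ^ (β - ν / 2) * t ^ α * s ^ (-(α + β))
      ≤ s ^ (β - ν / 2) * s ^ α * s ^ (-(α + β)) := by
        have h1 : x ^ (β - ν / 2) ≤ s ^ (β - ν / 2) :=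
          Real.rpow_le_rpow hx.le (by linarith) (by linarith)
        have h2 : t ^ α ≤ s ^ α := Real.rpow_le_rpow (by linarith) hts.le hα
        have h3 : 0 ≤ t ^ α := Real.rpow_nonneg (by linarith) _
        gcongr
    _ = s ^ (-(ν / 2)) := by
        rw [← Real.rpow_add hs0, ← Real.rpow_add hs0]
        congr 1
        ring
    _ ≤ (s - x) ^ (-(ν / 2)) :=
        Real.rpow_le_rpow_of_nonpos (by linarith) (by linarith) (by linarith)
    _ ≤ (s - x) ^ (-(1 / 2 + (ν + 1) / 4)) :=
        Real.rpow_le_rpow_of_exponent_ge (by linarith) (by linarith) (by linarith)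

theorem integral_rpow_sub_le {x t r σ : ℝ} (hxt : x < t) (htr : t ≤ r) (hσ : 0 < σ) :
    ∫ s in Ioo t r, ((s - x) ^ (-(1 / 2 + σ))) ^ 2 ≤ (t - x) ^ (-(2 * σ)) / (2 * σ) := by
  have h1 : ∫ s in Ioo t r, ((s - x) ^ (-(1 / 2 + σ))) ^ 2 =
      ∫ s in t..r, (s - x) ^ (-(1 + 2 * σ)) := by
    rw [intervalIntegral.integral_of_le htr, integral_Ioc_eq_integral_Ioo]
    refine setIntegral_congr_fun measurableSet_Ioo fun s hs => ?_
    have : 0 ≤ s - x := by linarith [hs.1]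
    rw [← Real.rpow_natCast, ← Real.rpow_mul this]
    congr 1
    push_cast
    ring
  rw [h1, intervalIntegral.integral_comp_sub_right (fun s => s ^ (-(1 + 2 * σ))) x, integral_rpow]
  · have h2 : 0 ≤ (r - x) ^ (-(1 + 2 * σ) + 1) := Real.rpow_nonneg (by linarith) _
    have e : -(1 + 2 * σ) + 1 = -(2 * σ) := by ring
    rw [e] at h2 ⊢
    rw [div_neg, ← neg_div]
    gcongr
    linarith
  · right
    refine ⟨by linarith, fun h => ?_⟩
    rw [uIcc_of_le (by linarith)] at h
    linarith [h.1]

theorem integral_rpow_sub_le_one {x σ : ℝ} (hσ : σ < 1) {r : ℝ} (hxr : x ≤ r) (hr : r ≤ x + 1) :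
    IntegrableOn (fun t => (t - x) ^ (-σ)) (Ioo x r) ∧
      ∫ t in Ioo x r, (t - x) ^ (-σ) ≤ (1 - σ)⁻¹ := by
  constructor
  · have h := (intervalIntegral.intervalIntegrable_rpow' (a := 0) (b := r - x) (r := -σ)
      (by linarith)).comp_sub_right x
    rw [zero_add, sub_add_cancel, intervalIntegrable_iff_integrableOn_Ioo_of_le hxr] at h
    exact h
  · rw [← integral_Ioc_eq_integral_Ioo, ← intervalIntegral.integral_of_le hxr,
      intervalIntegral.integral_comp_sub_right (fun s => s ^ (-σ)) x,
      integral_rpow (Or.inl (by linarith)), sub_self, Real.zero_rpow (by linarith), sub_zero,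
      show -σ + 1 = 1 - σ by ring, ← one_div]
    have : (r - x) ^ (1 - σ) ≤ 1 := Real.rpow_le_one (by linarith) (by linarith) (by linarith)
    have h0 : 0 < 1 - σ := by linarith
    gcongr

theorem setIntegral_norm_sq_le (g : L2 b) {t : ℝ} (ht : b ≤ t) :
    ∫ s in Ioo t (b + 1), ‖g s‖ ^ 2 ≤ ‖g‖ ^ 2 := by
  rw [norm_sq_eq_integral]
  exact setIntegral_mono_set (integrable_norm_sq g)
    (Filter.Eventually.of_forall fun _ => sq_nonneg _)
    (Ioo_subset_Ioo_left ht).eventuallyLE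

theorem norm_tail_weight_le {α β ν : ℝ} (hb : 0 < b) (hα : 0 ≤ α) (hν : 0 ≤ ν) (hν3 : ν < 3)
    (hνβ : ν ≤ 2 * β) (g : L2 b) {x t : ℝ} (hx : x ∈ Ioo b (b + 1)) (hxt : x < t)
    (ht : t < b + 1) :
    x ^ (β - ν / 2) * t ^ α * ‖tail (powOp hb (-(α + β)) g) b t‖ ≤
      (√((ν + 1) / 2))⁻¹ * ‖g‖ * (t - x) ^ (-((ν + 1) / 4)) := by
  set σ := (ν + 1) / 4 with hσ
  have hσ0 : 0 < σ := by positivity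
  have hbt : b ≤ t := (hx.1.trans hxt).le
  have hx0 : 0 < x := hb.trans hx.1
  have hgm : MemLp (fun s => ‖g s‖) 2 (volume.restrict (Ioo t (b + 1))) :=
    (Lp.memLp g).norm.mono_measure (Measure.restrict_mono (Ioo_subset_Ioo_left hbt) le_rfl)
  have hk₁ : MemLp (fun s : ℝ => s ^ (-(α + β))) 2 (volume.restrict (Ioo t (b + 1))) :=
    memLp_of_continuousOn_Icc (fun s hs => (Real.continuousAt_rpow_const s _
      (Or.inl (by linarith [hs.1]))).continuousWithinAt) 2
  have hk₂ : MemLp (fun s : ℝ => (s - x) ^ (-(1 / 2 + σ))) 2 (volume.restrict (Ioo t (b + 1))) :=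
    memLp_of_continuousOn_Icc (fun s hs => (ContinuousAt.rpow_const (by fun_prop)
      (Or.inl (by linarith [hs.1]))).continuousWithinAt) 2
  have h1 : ‖tail (powOp hb (-(α + β)) g) b t‖ ≤
      ∫ s in Ioo t (b + 1), s ^ (-(α + β)) * ‖g s‖ := by
    rw [tail_congr (coeFn_powOp hb _ g), tail, restrict_Ioi hbt]
    refine (norm_integral_le_integral_norm _).trans (le_of_eq ?_)
    refine setIntegral_congr_fun measurableSet_Ioo fun s hs => ?_
    simp only [norm_mul, Complex.norm_real]
    rw [Real.norm_of_nonneg (Real.rpow_nonneg (by linarith [hs.1]) _)]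
  have hw0 : 0 ≤ x ^ (β - ν / 2) * t ^ α :=
    mul_nonneg (Real.rpow_nonneg hx0.le _) (Real.rpow_nonneg (by linarith) _)
  calc x ^ (β - ν / 2) * t ^ α * ‖tail (powOp hb (-(α + β)) g) b t‖
      ≤ x ^ (β - ν / 2) * t ^ α * ∫ s in Ioo t (b + 1), s ^ (-(α + β)) * ‖g s‖ :=
        mul_le_mul_of_nonneg_left h1 hw0
    _ = ∫ s in Ioo t (b + 1), x ^ (β - ν / 2) * t ^ α * (s ^ (-(α + β)) * ‖g s‖) :=
        (integral_const_mul _ _).symm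
    _ ≤ ∫ s in Ioo t (b + 1), (s - x) ^ (-(1 / 2 + σ)) * ‖g s‖ := by
        refine setIntegral_mono_on ((hk₁.integrable_mul hgm).const_mul _)
          (hk₂.integrable_mul hgm) measurableSet_Ioo fun s hs => ?_
        rw [← mul_assoc]
        exact mul_le_mul_of_nonneg_right
          (weight_le hα hν hν3 hνβ hx0 hxt hs.1 (by linarith [hs.2, hx.1])) (norm_nonneg _)
    _ ≤ √(∫ s in Ioo t (b + 1), ((s - x) ^ (-(1 / 2 + σ))) ^ 2) *
          √(∫ s in Ioo t (b + 1), ‖g s‖ ^ 2) := by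
        refine integral_mul_le_sqrt hk₂ hgm ?_ (Filter.Eventually.of_forall fun _ => norm_nonneg _)
        filter_upwards [ae_restrict_mem measurableSet_Ioo] with s hs
        exact Real.rpow_nonneg (by linarith [hs.1]) _
    _ ≤ √((t - x) ^ (-(2 * σ)) / (2 * σ)) * √(‖g‖ ^ 2) :=
        mul_le_mul (Real.sqrt_le_sqrt (integral_rpow_sub_le hxt ht.le hσ0))
          (Real.sqrt_le_sqrt (setIntegral_norm_sq_le g hbt)) (Real.sqrt_nonneg _)
          (Real.sqrt_nonneg _)
    _ = (√((ν + 1) / 2))⁻¹ * ‖g‖ * (t - x) ^ (-σ) := by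
        have h2 : (t - x) ^ (-(2 * σ)) = ((t - x) ^ (-σ)) ^ 2 := by
          rw [← Real.rpow_natCast, ← Real.rpow_mul (by linarith)]
          congr 1
          push_cast
          ring
        have h3 : 2 * σ = (ν + 1) / 2 := by rw [hσ]; ring
        rw [Real.sqrt_sq (norm_nonneg g), h2, h3, Real.sqrt_div (sq_nonneg _),
          Real.sqrt_sq (Real.rpow_nonneg (by linarith) _)]
        ring

/-- The constant in the pointwise bound for the solution operator. -/
def solConst (ν : ℝ) : ℝ := (√((ν + 1) / 2))⁻¹ * (1 - (ν + 1) / 4)⁻¹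

theorem solConst_nonneg {ν : ℝ} (hν3 : ν < 3) : 0 ≤ solConst ν :=
  mul_nonneg (inv_nonneg.2 (Real.sqrt_nonneg _)) (inv_nonneg.2 (by linarith))

/-- Split off `x^(ν/2)` from `x^β` and move the remaining `x^(β-ν/2)` under both integrals. The
inner one is bounded by `norm_tail_weight_le`, and integrating `(t-x)^(-σ)` over an interval of
length at most one gives the factor `(1-σ)⁻¹`. -/
theorem norm_solL_le {α β ν : ℝ} (hb : 0 < b) (hα : 0 ≤ α) (hν : 0 ≤ ν) (hν3 : ν < 3)
    (hνβ : ν ≤ 2 * β) (g : L2 b) :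
    ∀ᵐ x ∂(μ b), ‖solL hb α β g x‖ ≤ x ^ (ν / 2) * (solConst ν * ‖g‖) := by
  set G := powOp hb (-(α + β)) g with hG
  filter_upwards [coeFn_powOp hb β (tailL b (powOp hb α (tailL b G))),
    coeFn_tailL (powOp hb α (tailL b G)), ae_restrict_mem measurableSet_Ioo] with x h1 h2 hx
  have hx0 : 0 < x := hb.trans hx.1
  have hae : powOp hb α (tailL b G) =ᵐ[μ b] fun t => ((t ^ α : ℝ) : ℂ) * tail G b t := by
    filter_upwards [coeFn_powOp hb α (tailL b G), coeFn_tailL G] with t h3 h4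
    rw [h3, h4]
  have hsplit : x ^ β = x ^ (ν / 2) * x ^ (β - ν / 2) := by
    rw [← Real.rpow_add hx0]
    congr 1
    ring
  rw [solL_apply, h1, h2, norm_mul, Complex.norm_real,
    Real.norm_of_nonneg (Real.rpow_nonneg hx0.le _), hsplit, mul_assoc]
  refine mul_le_mul_of_nonneg_left ?_ (Real.rpow_nonneg hx0.le _)
  rw [tail_congr hae, tail, restrict_Ioi hx.1.le]
  have hw0 : 0 ≤ x ^ (β - ν / 2) := Real.rpow_nonneg hx0.le _
  obtain ⟨hi, hle⟩ := integral_rpow_sub_le_one (x := x) (σ := (ν + 1) / 4) (by linarith)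
    (r := b + 1) hx.2.le (by linarith [hx.1])
  have hbd : ∀ t ∈ Ioo x (b + 1), x ^ (β - ν / 2) * ‖((t ^ α : ℝ) : ℂ) * tail G b t‖ ≤
      (√((ν + 1) / 2))⁻¹ * ‖g‖ * (t - x) ^ (-((ν + 1) / 4)) := by
    intro t ht
    rw [norm_mul, Complex.norm_real,
      Real.norm_of_nonneg (Real.rpow_nonneg (hx0.trans ht.1).le _), ← mul_assoc]
    exact norm_tail_weight_le hb hα hν hν3 hνβ g hx ht.1 ht.2
  have hc : ‖((x ^ (β - ν / 2) : ℝ) : ℂ)‖ = x ^ (β - ν / 2) := by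
    rw [Complex.norm_real, Real.norm_of_nonneg hw0]
  calc x ^ (β - ν / 2) * ‖∫ t in Ioo x (b + 1), ((t ^ α : ℝ) : ℂ) * tail G b t‖
      = ‖∫ t in Ioo x (b + 1), ((x ^ (β - ν / 2) : ℝ) : ℂ) * (((t ^ α : ℝ) : ℂ) * tail G b t)‖ := by
        rw [integral_const_mul, norm_mul, hc]
    _ ≤ ∫ t in Ioo x (b + 1), (√((ν + 1) / 2))⁻¹ * ‖g‖ * (t - x) ^ (-((ν + 1) / 4)) := by
        refine norm_integral_le_of_norm_le (hi.const_mul _) ?_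
        filter_upwards [ae_restrict_mem measurableSet_Ioo] with t ht
        rw [norm_mul, hc]
        exact hbd t ht
    _ = (√((ν + 1) / 2))⁻¹ * ‖g‖ * ∫ t in Ioo x (b + 1), (t - x) ^ (-((ν + 1) / 4)) :=
        integral_const_mul _ _
    _ ≤ (√((ν + 1) / 2))⁻¹ * ‖g‖ * (1 - (ν + 1) / 4)⁻¹ :=
        mul_le_mul_of_nonneg_left hle (by positivity)
    _ = solConst ν * ‖g‖ := by rw [solConst]; ring

/-! ### The estimate for the kernel of the form -/

/-- The functions annihilated by the form. -/
def kerFun (α β : ℝ) (c₀ c₁ : ℂ) (x : ℝ) : ℂ :=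
  ((x ^ β : ℝ) : ℂ) * (c₀ + c₁ * ((x ^ (α + 1) : ℝ) : ℂ))

theorem continuousOn_kerFun (hb : 0 < b) (α β : ℝ) (c₀ c₁ : ℂ) :
    ContinuousOn (kerFun α β c₀ c₁) (Icc b (b + 1)) := by
  have h : ∀ s : ℝ, ContinuousOn (fun x : ℝ => ((x ^ s : ℝ) : ℂ)) (Icc b (b + 1)) := fun s =>
    Complex.continuous_ofReal.comp_continuousOn fun x hx =>
      (Real.continuousAt_rpow_const x s (Or.inl (hb.trans_le hx.1).ne')).continuousWithinAt
  exact (h β).mul (continuousOn_const.add (continuousOn_const.mul (h (α + 1))))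

/-- Some point of the short interval lies at or below the average; the factor `8` is its inverse
length. -/
theorem exists_norm_sq_le {f : ℝ → ℂ} (hf : ContinuousOn f (Icc b (b + 1))) {l : ℝ} (hl : b ≤ l)
    (hl' : l + 1 / 8 ≤ b + 1) :
    ∃ y ∈ Ioo l (l + 1 / 8), ‖f y‖ ^ 2 ≤ 8 * ∫ x in Ioo b (b + 1), ‖f x‖ ^ 2 := by
  have hi : IntegrableOn (fun x => ‖f x‖ ^ 2) (Ioo b (b + 1)) :=
    ((hf.norm.pow 2).integrableOn_Icc).mono_set Ioo_subset_Icc_self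
  have hsub : Ioo l (l + 1 / 8) ⊆ Ioo b (b + 1) := Ioo_subset_Ioo hl hl'
  obtain ⟨y, hy, hle⟩ := exists_le_setAverage (s := Ioo l (l + 1 / 8)) (μ := volume)
    (by simp) (by simp) (hi.mono_set hsub)
  refine ⟨y, hy, hle.trans ?_⟩
  rw [setAverage_eq]
  have : volume.real (Ioo l (l + 1 / 8)) = 1 / 8 := by
    rw [Real.volume_real_Ioo_of_le (by linarith)]
    ring
  rw [this, smul_eq_mul]
  have h2 := setIntegral_mono_set hi (Filter.Eventually.of_forall fun _ => sq_nonneg _)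
    hsub.eventuallyLE
  norm_num
  linarith

theorem rpow_sub_rpow_le {s x y M : ℝ} (hs : 0 ≤ s) (hx : 0 < x) (hxM : x ≤ M) (hy : 0 < y)
    (hyM : y ≤ M) : |x ^ (s + 1) - y ^ (s + 1)| ≤ (s + 1) * M ^ s * |x - y| := by
  have hd : ∀ z ∈ Ioc 0 M, HasDerivWithinAt (fun z : ℝ => z ^ (s + 1)) ((s + 1) * z ^ s)
      (Ioc 0 M) z := fun z hz => by
    have h := Real.hasDerivAt_rpow_const (x := z) (p := s + 1) (Or.inl hz.1.ne')
    rw [add_sub_cancel_right] at h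
    exact h.hasDerivWithinAt
  refine (convex_Ioc 0 M).norm_image_sub_le_of_norm_hasDerivWithin_le hd (fun z hz => ?_)
    ⟨hy, hyM⟩ ⟨hx, hxM⟩
  rw [Real.norm_of_nonneg (mul_nonneg (by linarith) (Real.rpow_nonneg hz.1.le _))]
  exact mul_le_mul_of_nonneg_left (Real.rpow_le_rpow hz.1.le hz.2 hs) (by linarith)

theorem le_rpow_sub_rpow {s x y : ℝ} (hs : 0 ≤ s) (hx : 0 < x) (hxy : x ≤ y) :
    (s + 1) * x ^ s * (y - x) ≤ y ^ (s + 1) - x ^ (s + 1) := by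
  have hd : ∀ z ∈ Icc x y, HasDerivAt (fun z : ℝ => z ^ (s + 1)) ((s + 1) * z ^ s) z :=
    fun z hz => by
      have h := Real.hasDerivAt_rpow_const (x := z) (p := s + 1)
        (Or.inl (hx.trans_le hz.1).ne')
      rwa [add_sub_cancel_right] at h
  refine (convex_Icc x y).mul_sub_le_image_sub_of_le_deriv
    (fun z hz => (hd z hz).continuousAt.continuousWithinAt)
    (fun z hz => (hd z (interior_subset hz)).differentiableAt.differentiableWithinAt)
    (fun z hz => ?_) x (left_mem_Icc.2 hxy) y (right_mem_Icc.2 hxy) hxy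
  have hz' := interior_subset hz
  rw [(hd z hz').deriv]
  exact mul_le_mul_of_nonneg_left (Real.rpow_le_rpow hx.le hz'.1 hs) (by linarith)

/-- Extrapolation of an affine function of `x ^ (α + 1)`. -/
theorem norm_affine_le {α : ℝ} (hb : 0 < b) (hα : 0 ≤ α) (c₀ c₁ : ℂ) {x y z : ℝ}
    (hx : x ∈ Ioo b (b + 1)) (hy : y ∈ Ioo (b + 1 / 2) (b + 1 / 2 + 1 / 8))
    (hz : z ∈ Ioo (b + 7 / 8) (b + 7 / 8 + 1 / 8)) :
    ‖c₀ + c₁ * ((x ^ (α + 1) : ℝ) : ℂ)‖ ≤ 4 * 2 ^ α *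
      (‖c₀ + c₁ * ((y ^ (α + 1) : ℝ) : ℂ)‖ + ‖c₀ + c₁ * ((z ^ (α + 1) : ℝ) : ℂ)‖) := by
  obtain ⟨hx1, hx2⟩ := hx
  obtain ⟨hy1, hy2⟩ := hy
  obtain ⟨hz1, hz2⟩ := hz
  set X := x ^ (α + 1)
  set Y := y ^ (α + 1)
  set Z := z ^ (α + 1)
  set M := 4 * (2 : ℝ) ^ α with hM
  have hpow : (b + 1) ^ α ≤ 2 ^ α * y ^ α := by
    rw [← Real.mul_rpow (by norm_num) (by linarith)]
    exact Real.rpow_le_rpow (by linarith) (by linarith) hα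
  have hlow := le_rpow_sub_rpow (x := y) (y := z) hα (by linarith) (by linarith)
  have hya : 0 < y ^ α := Real.rpow_pos_of_pos (by linarith) _
  have hZY : 0 < Z - Y := lt_of_lt_of_le
    (mul_pos (mul_pos (by linarith) hya) (by linarith)) hlow
  -- The nodes lie at least `1/4` apart and `b + 1 ≤ 2 y`. So the upper slope bound at `b + 1` and
  -- the lower one at `y` are comparable, with a ratio independent of `b`.
  have hup : ∀ w, b < w → w < b + 1 → |X - w ^ (α + 1)| ≤ M * (Z - Y) := by
    intro w hw1 hw2
    calc |X - w ^ (α + 1)| ≤ (α + 1) * (b + 1) ^ α * |x - w| :=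
          rpow_sub_rpow_le hα (by linarith) hx2.le (by linarith) hw2.le
      _ ≤ (α + 1) * (2 ^ α * y ^ α) * 1 := by
          have : |x - w| ≤ 1 := abs_le.2 ⟨by linarith, by linarith⟩
          gcongr
      _ = M * ((α + 1) * y ^ α * (1 / 4)) := by rw [hM]; ring
      _ ≤ M * ((α + 1) * y ^ α * (z - y)) := by
          have : (1 / 4 : ℝ) ≤ z - y := by linarith
          gcongr
      _ ≤ M * (Z - Y) := by gcongr
  have hXZ := hup z (by linarith) (by linarith)
  have hXY := hup y (by linarith) (by linarith)
  -- Lagrange interpolation of an affine function at `Y` and `Z`, cleared of denominators.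
  have hid : ((Z - Y : ℝ) : ℂ) * (c₀ + c₁ * (X : ℂ)) =
      ((X - Y : ℝ) : ℂ) * (c₀ + c₁ * (Z : ℂ)) - ((X - Z : ℝ) : ℂ) * (c₀ + c₁ * (Y : ℂ)) := by
    push_cast
    ring
  have h1 : (Z - Y) * ‖c₀ + c₁ * (X : ℂ)‖ ≤
      M * (Z - Y) * ‖c₀ + c₁ * (Z : ℂ)‖ + M * (Z - Y) * ‖c₀ + c₁ * (Y : ℂ)‖ := by
    have h2 := congrArg norm hid
    rw [norm_mul, Complex.norm_real, Real.norm_of_nonneg hZY.le] at h2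
    rw [h2]
    refine (norm_sub_le _ _).trans ?_
    rw [norm_mul, norm_mul, Complex.norm_real, Complex.norm_real, Real.norm_eq_abs,
      Real.norm_eq_abs]
    gcongr
  have h3 : (Z - Y) * ‖c₀ + c₁ * (X : ℂ)‖ ≤
      (Z - Y) * (M * (‖c₀ + c₁ * (Y : ℂ)‖ + ‖c₀ + c₁ * (Z : ℂ)‖)) := by linarith
  exact le_of_mul_le_mul_left h3 hZY

/-- The constant in the pointwise bound for the kernel of the form. -/
def kerConst (α β : ℝ) : ℝ := 2 ^ β * (4 * 2 ^ α) * (2 * √8)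

/-- Up to `x^β` these functions are affine in `x^(α+1)`, hence determined by two values. The nodes
are taken in the right half of the interval, where `x^β` does not degenerate as `b → 0`, at points
where the function is controlled by its `L²` norm. -/
theorem norm_kerFun_le {α β ν : ℝ} (hb : 0 < b) (hα : 0 ≤ α) (hν : 0 ≤ ν)
    (hνβ : ν ≤ 2 * β) (c₀ c₁ : ℂ) {x : ℝ} (hx : x ∈ Ioo b (b + 1)) :
    ‖kerFun α β c₀ c₁ x‖ ≤ x ^ (ν / 2) *
      (kerConst α β * √(∫ x in Ioo b (b + 1), ‖kerFun α β c₀ c₁ x‖ ^ 2)) := by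
  have hc := continuousOn_kerFun hb α β c₀ c₁
  obtain ⟨y, hy, hy'⟩ := exists_norm_sq_le hc (l := b + 1 / 2) (by linarith) (by linarith)
  obtain ⟨z, hz, hz'⟩ := exists_norm_sq_le hc (l := b + 7 / 8) (by linarith) (by linarith)
  set I := ∫ x in Ioo b (b + 1), ‖kerFun α β c₀ c₁ x‖ ^ 2
  have hx0 : 0 < x := hb.trans hx.1
  have hI : ∀ {w : ℝ}, ‖kerFun α β c₀ c₁ w‖ ^ 2 ≤ 8 * I → ‖kerFun α β c₀ c₁ w‖ ≤ √8 * √I := by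
    intro w hw
    rw [← Real.sqrt_mul (by norm_num)]
    exact Real.le_sqrt_of_sq_le hw
  have hnorm : ∀ w : ℝ, 0 < w → ‖kerFun α β c₀ c₁ w‖ =
      w ^ β * ‖c₀ + c₁ * ((w ^ (α + 1) : ℝ) : ℂ)‖ := by
    intro w hw
    rw [kerFun, norm_mul, Complex.norm_real, Real.norm_of_nonneg (Real.rpow_nonneg hw.le _)]
  -- Both `x ≤ 2 w` and `1 ≤ 2 w` hold; the latter allows the exponent to be raised to `β`.
  have hpow : ∀ {w : ℝ}, b + 1 / 2 < w → x ^ (β - ν / 2) ≤ 2 ^ β * w ^ β := by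
    intro w hw
    rw [← Real.mul_rpow (by norm_num) (by linarith)]
    calc x ^ (β - ν / 2) ≤ (2 * w) ^ (β - ν / 2) :=
          Real.rpow_le_rpow hx0.le (by linarith [hx.2]) (by linarith)
      _ ≤ (2 * w) ^ β := Real.rpow_le_rpow_of_exponent_le (by linarith) (by linarith)
  have hkey : ∀ {w : ℝ}, b + 1 / 2 < w → ‖kerFun α β c₀ c₁ w‖ ^ 2 ≤ 8 * I →
      x ^ (β - ν / 2) * ‖c₀ + c₁ * ((w ^ (α + 1) : ℝ) : ℂ)‖ ≤ 2 ^ β * (√8 * √I) := by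
    intro w hw hw'
    refine (mul_le_mul_of_nonneg_right (hpow hw) (norm_nonneg _)).trans ?_
    rw [mul_assoc, ← hnorm w (by linarith)]
    exact mul_le_mul_of_nonneg_left (hI hw') (by positivity)
  have h1 := hkey (by linarith [hy.1]) hy'
  have h2 := hkey (by linarith [hz.1]) hz'
  have h3 := norm_affine_le hb hα c₀ c₁ hx hy hz
  have hsplit : x ^ β = x ^ (ν / 2) * x ^ (β - ν / 2) := by
    rw [← Real.rpow_add hx0]
    congr 1
    ring
  rw [hnorm x hx0, hsplit, mul_assoc]
  refine mul_le_mul_of_nonneg_left ?_ (Real.rpow_nonneg hx0.le _)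
  calc x ^ (β - ν / 2) * ‖c₀ + c₁ * ((x ^ (α + 1) : ℝ) : ℂ)‖
      ≤ x ^ (β - ν / 2) * (4 * 2 ^ α * (‖c₀ + c₁ * ((y ^ (α + 1) : ℝ) : ℂ)‖ +
          ‖c₀ + c₁ * ((z ^ (α + 1) : ℝ) : ℂ)‖)) :=
        mul_le_mul_of_nonneg_left h3 (Real.rpow_nonneg hx0.le _)
    _ = 4 * 2 ^ α * (x ^ (β - ν / 2) * ‖c₀ + c₁ * ((y ^ (α + 1) : ℝ) : ℂ)‖ +
          x ^ (β - ν / 2) * ‖c₀ + c₁ * ((z ^ (α + 1) : ℝ) : ℂ)‖) := by ring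
    _ ≤ 4 * 2 ^ α * (2 ^ β * (√8 * √I) + 2 ^ β * (√8 * √I)) :=
        mul_le_mul_of_nonneg_left (add_le_add h1 h2) (by positivity)
    _ = kerConst α β * √I := by rw [kerConst]; ring

/-! ### Bounds for the potential -/

theorem coeFn_ker (hb : 0 < b) (α β : ℝ) (c₀ c₁ : ℂ) :
    (c₀ • powOp hb β (one b) + c₁ • powOp hb (α + β + 1) (one b) : L2 b) =ᵐ[μ b]
      kerFun α β c₀ c₁ := by
  filter_upwards [Lp.coeFn_add (c₀ • powOp hb β (one b)) (c₁ • powOp hb (α + β + 1) (one b)),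
    Lp.coeFn_smul c₀ (powOp hb β (one b)), Lp.coeFn_smul c₁ (powOp hb (α + β + 1) (one b)),
    coeFn_powOp hb β (one b), coeFn_powOp hb (α + β + 1) (one b), coeFn_one (b := b),
    ae_restrict_mem measurableSet_Ioo] with x h1 h2 h3 h4 h5 h6 hx
  rw [h1, Pi.add_apply, h2, h3, Pi.smul_apply, Pi.smul_apply, h4, h5, h6, kerFun,
    show α + β + 1 = β + (α + 1) by ring, Real.rpow_add (hb.trans hx.1)]
  simp only [smul_eq_mul]
  push_cast
  ring

theorem norm_ker (hb : 0 < b) (α β : ℝ) (c₀ c₁ : ℂ) :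
    ‖(c₀ • powOp hb β (one b) + c₁ • powOp hb (α + β + 1) (one b) : L2 b)‖ =
      √(∫ x in Ioo b (b + 1), ‖kerFun α β c₀ c₁ x‖ ^ 2) := by
  rw [← Real.sqrt_sq (norm_nonneg _), norm_sq_eq_integral]
  congr 1
  apply integral_congr_ae
  filter_upwards [coeFn_ker hb α β c₀ c₁] with x hx
  rw [hx]

/-- The constant in the pointwise bound for elements of `H²(b, b + 1)`. -/
def supConst (α β ν : ℝ) : ℝ := 1 + solConst ν + kerConst α β * (1 + solConst 0)

/-- The kernel part `p` is bounded pointwise through `‖p‖`, and `p = u - S g` returns `‖p‖` to `‖u‖`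
and `‖g‖`; the case `ν = 0` of `norm_solL_le` supplies the `L²` bound for `S`. -/
theorem norm_paramL_le {α β ν : ℝ} (hb : 0 < b) (hα : 0 ≤ α) (hβ : 0 ≤ β) (hν : 0 ≤ ν)
    (hν3 : ν < 3) (hνβ : ν ≤ 2 * β) (k : Param b) :
    ∀ᵐ x ∂(μ b), ‖paramL hb α β k x‖ ≤
      x ^ (ν / 2) * (supConst α β ν * (‖k.snd‖ + ‖paramL hb α β k‖)) := by
  set p : L2 b := k.fst 0 • powOp hb β (one b) + k.fst 1 • powOp hb (α + β + 1) (one b) with hp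
  have hu : paramL hb α β k = p + solL hb α β k.snd := paramL_apply hb α β k
  have hs0 := solConst_nonneg (ν := 0) (by norm_num)
  have hsν := solConst_nonneg hν3
  have hk0 : 0 ≤ kerConst α β := by rw [kerConst]; positivity
  have hsol : ‖solL hb α β k.snd‖ ≤ solConst 0 * ‖k.snd‖ := by
    refine norm_le_of_ae_le (by positivity) ?_
    filter_upwards [norm_solL_le hb hα (le_refl 0) (by norm_num) (by linarith) (β := β) k.snd]
      with x hx
    simpa using hx
  have hpn : ‖p‖ ≤ ‖paramL hb α β k‖ + solConst 0 * ‖k.snd‖ := by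
    have : p = paramL hb α β k - solL hb α β k.snd := by rw [hu, add_sub_cancel_right]
    rw [this]
    exact (norm_sub_le _ _).trans (by linarith)
  filter_upwards [norm_solL_le hb hα hν hν3 hνβ k.snd, coeFn_ker hb α β (k.fst 0) (k.fst 1),
    Lp.coeFn_add p (solL hb α β k.snd), ae_restrict_mem measurableSet_Ioo] with x h1 h2 h3 hx
  have h4 := norm_kerFun_le hb hα hν hνβ (k.fst 0) (k.fst 1) hx
  rw [← norm_ker hb, ← hp, ← h2, ← hp] at h4
  have hx0 : 0 ≤ x ^ (ν / 2) := Real.rpow_nonneg (hb.trans hx.1).le _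
  have h5 : ‖paramL hb α β k x‖ ≤ ‖p x‖ + ‖solL hb α β k.snd x‖ := by
    rw [hu, h3, Pi.add_apply]
    exact norm_add_le _ _
  calc ‖paramL hb α β k x‖
      ≤ x ^ (ν / 2) * (kerConst α β * ‖p‖ + solConst ν * ‖k.snd‖) := by linarith
    _ ≤ x ^ (ν / 2) * (supConst α β ν * (‖k.snd‖ + ‖paramL hb α β k‖)) := by
        refine mul_le_mul_of_nonneg_left ?_ hx0
        have h6 := mul_le_mul_of_nonneg_left hpn hk0
        have n1 := norm_nonneg k.snd
        have n2 := norm_nonneg (paramL hb α β k)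
        have m1 := mul_nonneg hk0 n1
        have m2 := mul_nonneg (mul_nonneg hk0 hs0) n2
        have m3 := mul_nonneg hsν n2
        rw [supConst]
        linarith

theorem re_inner_mulL (V : ℝ → ℝ) (hV : MemLp V ∞ (μ b)) (u : L2 b) :
    (inner ℂ u (mulL V hV u)).re = ∫ x, V x * ‖u x‖ ^ 2 ∂(μ b) ∧
      Integrable (fun x => V x * ‖u x‖ ^ 2) (μ b) := by
  have h : (fun x => inner ℂ (u x) (mulL V hV u x)) =ᵐ[μ b]
      fun x => ((V x * ‖u x‖ ^ 2 : ℝ) : ℂ) := by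
    filter_upwards [coeFn_mulOp V hV u] with x hx
    rw [mulL_apply, hx, RCLike.inner_apply, mul_assoc, Complex.mul_conj']
    push_cast
    rfl
  constructor
  · rw [L2.inner_def, integral_congr_ae h, integral_complex_ofReal, Complex.ofReal_re]
  · have h2 := (L2.integrable_inner (𝕜 := ℂ) u (mulL V hV u)).congr h
    exact h2.re.congr (Filter.Eventually.of_forall fun x => Complex.ofReal_re _)

theorem re_inner_mulL_le {V : ℝ → ℝ} (hV : MemLp V ∞ (μ b)) (hb : 0 < b) {ν D M : ℝ}
    (hV0 : ∀ᵐ x ∂(μ b), 0 ≤ V x) (hD : ∫ x in Ioo b (b + 1), V x * x ^ ν ≤ D) {u : L2 b}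
    (hu : ∀ᵐ x ∂(μ b), ‖u x‖ ≤ x ^ (ν / 2) * M) :
    (inner ℂ u (mulL V hV u)).re ≤ D * M ^ 2 := by
  have hi : Integrable (fun x => V x * x ^ ν) (μ b) :=
    (MemLp.mul (p := ∞) (q := ∞) (r := ∞) hV (memLp_rpow hb ν)).integrable (by simp) |>.congr
      (Filter.Eventually.of_forall fun x => by simp [mul_comm])
  rw [(re_inner_mulL V hV u).1]
  calc ∫ x, V x * ‖u x‖ ^ 2 ∂(μ b) ≤ ∫ x, V x * x ^ ν * M ^ 2 ∂(μ b) := by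
        refine integral_mono_ae (re_inner_mulL V hV u).2 (hi.mul_const _) ?_
        filter_upwards [hV0, hu, ae_restrict_mem measurableSet_Ioo] with x h1 h2 hx
        have h3 : (x ^ (ν / 2)) ^ 2 = x ^ ν := by
          rw [← Real.rpow_natCast, ← Real.rpow_mul (hb.trans hx.1).le]
          congr 1
          push_cast
          ring
        rw [mul_assoc, ← h3, ← mul_pow]
        exact mul_le_mul_of_nonneg_left (pow_le_pow_left₀ (norm_nonneg _) h2 2) h1
    _ = (∫ x in Ioo b (b + 1), V x * x ^ ν) * M ^ 2 := integral_mul_const _ _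
    _ ≤ D * M ^ 2 := mul_le_mul_of_nonneg_right hD (sq_nonneg _)

theorem subsingleton_zeros_kerFun {α β : ℝ} (hα : 0 ≤ α) {c₀ c₁ : ℂ} (hc : c₀ ≠ 0 ∨ c₁ ≠ 0) :
    {x : ℝ | 0 < x ∧ kerFun α β c₀ c₁ x = 0}.Subsingleton := by
  have h : ∀ x : ℝ, 0 < x → kerFun α β c₀ c₁ x = 0 →
      c₀ + c₁ * ((x ^ (α + 1) : ℝ) : ℂ) = 0 := by
    intro x hx h0
    rw [kerFun, mul_eq_zero] at h0
    refine h0.resolve_left ?_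
    exact_mod_cast (Real.rpow_pos_of_pos hx β).ne'
  rintro x ⟨hx, hx0⟩ y ⟨hy, hy0⟩
  have h1 := h x hx hx0
  have h2 := h y hy hy0
  have hc₁ : c₁ ≠ 0 := by
    rintro rfl
    rw [zero_mul, add_zero] at h1
    simp [h1] at hc
  have h3 : c₁ * ((x ^ (α + 1) : ℝ) : ℂ) = c₁ * ((y ^ (α + 1) : ℝ) : ℂ) := by
    linear_combination h1 - h2
  have h4 : x ^ (α + 1) = y ^ (α + 1) := by exact_mod_cast mul_left_cancel₀ hc₁ h3
  exact (Real.rpow_left_inj hx.le hy.le (by linarith)).1 h4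

/-- If the integral vanished, so would `V |u|²` almost everywhere; as `u` has at most one zero, `V`
would vanish almost everywhere. -/
theorem re_inner_mulL_pos {α β : ℝ} (hb : 0 < b) (hα : 0 ≤ α) {V : ℝ → ℝ}
    (hV : MemLp V ∞ (μ b)) (hV0 : ∀ᵐ x ∂(μ b), 0 ≤ V x) (hVne : ¬ ∀ᵐ x ∂(μ b), V x = 0)
    {k : Param b} (hk : sndProj b k = 0) (hk0 : k ≠ 0) :
    0 < (inner ℂ (paramL hb α β k) (mulL V hV (paramL hb α β k))).re := by
  have hsnd := sndProj_eq_zero.1 hk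
  have hc : k.fst 0 ≠ 0 ∨ k.fst 1 ≠ 0 := by
    by_contra! h
    apply hk0
    have h1 : k.fst = 0 := by
      ext i
      fin_cases i
      · exact h.1
      · exact h.2
    have : k = WithLp.toLp 2 (k.fst, k.snd) := rfl
    rw [this, h1, hsnd]
    rfl
  obtain ⟨he, hi⟩ := re_inner_mulL V hV (paramL hb α β k)
  have hnn : 0 ≤ᵐ[μ b] fun x => V x * ‖paramL hb α β k x‖ ^ 2 := by
    filter_upwards [hV0] with x hx
    exact mul_nonneg hx (sq_nonneg _)
  rw [he]
  refine (integral_nonneg_of_ae hnn).lt_of_ne fun h0 => hVne ?_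
  have hz := (integral_eq_zero_iff_of_nonneg_ae hnn hi).1 h0.symm
  have hu : paramL hb α β k =ᵐ[μ b] kerFun α β (k.fst 0) (k.fst 1) := by
    rw [paramL_apply, hsnd, map_zero, add_zero]
    exact coeFn_ker hb α β _ _
  have hnull : ∀ᵐ x ∂(μ b), ¬ (0 < x ∧ kerFun α β (k.fst 0) (k.fst 1) x = 0) := by
    refine ae_restrict_of_ae ?_
    rw [ae_iff]
    simpa using (subsingleton_zeros_kerFun (β := β) hα hc).measure_zero volume
  filter_upwards [hz, hu, hnull, ae_restrict_mem measurableSet_Ioo] with x h1 h2 h3 hx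
  have h4 : V x * ‖paramL hb α β k x‖ ^ 2 = 0 := h1
  rw [h2] at h4
  refine (mul_eq_zero.1 h4).resolve_right fun h5 => h3 ⟨hb.trans hx.1, ?_⟩
  simpa using h5

end IntervalOp

end

/-! ### Choice of the constants and conclusion -/

theorem proposition3 (α β ν : ℝ) (hα : 0 ≤ α) (hβ : 0 ≤ β) (hβα : β < 3 / 2 + α)
    (hν : 0 ≤ ν) (hν3 : ν < 3) (hνβ : ν ≤ 2 * β) :
    ∃ D E : ℝ, 0 < D ∧ 0 < E ∧
      ∀ (b : ℝ) (hb : 0 < b) (V : ℝ → ℝ) (hV : MemLp V ∞ (IntervalOp.μ b)),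
        (∀ᵐ x ∂(IntervalOp.μ b), 0 ≤ V x) →
        (¬ ∀ᵐ x ∂(IntervalOp.μ b), V x = 0) →
        ∫ x in Ioo b (b + 1), V x * x ^ ν ≤ D →
        ∃ E₁ E₂ : ℝ, 0 < E₁ ∧ 0 < E₂ ∧ E₁ ≤ E ∧ E₂ ≤ E ∧
          IntervalOp.negSpectrum (IntervalOp.HbSub hb α β V hV) = {-E₁, -E₂} ∧
          -- counted with multiplicity: `t < 0` is an eigenvalue as often as it occurs
          -- among `-E₁` and `-E₂`
          ∀ t : ℝ, t < 0 →
            Module.rank ℂ (IntervalOp.eigenspace (IntervalOp.HbSub hb α β V hV) (t : ℂ)) =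
              (if t = -E₁ then 1 else 0) + (if t = -E₂ then 1 else 0) := by
  open IntervalOp in
  have hs0 := solConst_nonneg (ν := 0) (by norm_num)
  have hsν := solConst_nonneg hν3
  have hk0 : 0 ≤ kerConst α β := by rw [kerConst]; positivity
  set C := supConst α β ν with hC
  have hC1 : 1 + solConst ν ≤ C := by
    have := mul_nonneg hk0 (by linarith : (0 : ℝ) ≤ 1 + solConst 0)
    rw [hC, supConst]
    linarith
  have hCpos : 0 < C ^ 2 := by
    have : 0 < C := by linarith
    positivity
  -- With `D C² = 1/4` the potential term is at most `(‖g‖ + ‖u‖)²/4 ≤ (‖g‖² + ‖u‖²)/2`, whence `E =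
  -- 1/2`; on the range of `P` it is at most `‖g‖²/4`, within the required `1/2`.
  refine ⟨(4 * C ^ 2)⁻¹, 1 / 2, by positivity, by norm_num, ?_⟩
  intro b hb V hV hV0 hVne hD
  have hCC : (4 * C ^ 2)⁻¹ * C ^ 2 = 1 / 4 := by
    rw [mul_inv, mul_assoc, inv_mul_cancel₀ hCpos.ne']
    norm_num
  refine exists_negSpectrum_eq (J := paramL hb α β) (W := mulL V hV) sndProj_isSymmetric
    sndProj_sndProj finrank_ker_sndProj (inner_mulOp_left V hV) (fun k hk => ?_)
    (fun k hk hk0 => re_inner_mulL_pos hb hα hV hV0 hVne hk hk0) (fun k => ?_) _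
    (mem_graph_HbSub_iff hb hα V hV)
  · have hf := fst_eq_zero_of_sndProj_eq hk
    have hu : paramL hb α β k = solL hb α β k.snd := by
      rw [paramL_apply, hf]
      simp
    have h1 := re_inner_mulL_le hV hb hV0 hD (norm_solL_le hb hα hν hν3 hνβ k.snd)
    rw [← hu] at h1
    have h2 : ‖k‖ = ‖k.snd‖ := by rw [← norm_sndProj, hk]
    rw [h2]
    refine h1.trans ?_
    have h3 : (solConst ν) ^ 2 ≤ C ^ 2 := pow_le_pow_left₀ hsν (by linarith) 2
    calc (4 * C ^ 2)⁻¹ * (solConst ν * ‖k.snd‖) ^ 2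
        = (4 * C ^ 2)⁻¹ * (solConst ν) ^ 2 * ‖k.snd‖ ^ 2 := by ring
      _ ≤ (4 * C ^ 2)⁻¹ * C ^ 2 * ‖k.snd‖ ^ 2 := by gcongr
      _ ≤ 1 / 2 * ‖k.snd‖ ^ 2 := by
        rw [hCC]
        nlinarith [sq_nonneg ‖k.snd‖]
  · have h1 := re_inner_mulL_le hV hb hV0 hD (norm_paramL_le hb hα hβ hν hν3 hνβ k)
    refine h1.trans ?_
    rw [norm_sndProj, ← hC, mul_pow, ← mul_assoc, hCC]
    nlinarith [sq_nonneg (‖k.snd‖ - ‖paramL hb α β k‖), sq_nonneg ‖k.snd‖]
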